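/- Let $A$ be a $C^*$-algebra (not necessarily unital). An *infinite free product* $\mathcal P A=A*A*\cdots$ is a $C^*$-algebra $P$ with a sequence of $*$-homomorphisms $\theta^P_0,\theta^P_1,\dots:A\to P$ such that $P$ is generated by $\bigcup_k\theta^P_k(A)$ and for every $C^*$-algebra $D$ and every sequence of $*$-homomorphisms $\pi_0,\pi_1,\dots:A\to D$ there is a unique $*$-homomorphism $\rho:P\to D$ with $\rho\circ\theta^P_k=\pi_k$ for all $k\ge 0$. Let $S$ be the set of finite sequences $\nu=(n_1,\dots,n_k)$, $k\ge1$, of nonnegative integers with $n_i\ne n_{i+1}$ for $1\le i<k$, with product $(m_1,\dots,m_k)\cdot(n_1,\dots,n_\ell)=(m_1,\dots,m_k,n_1,\dots,n_\ell)$ if $m_k\neq n_1$ and $=(m_1,\dots,m_k,n_2,\dots,n_\ell)$ if $m_k=n_1$, and involution $(m_1,\dots,m_k)^*=(m_k,\dots,m_1)$. For $\nu\in S$ of length $k$ let $\Sigma_\nu=A\hat\otimes\cdots\hat\otimes A$ be the $k$-fold projective tensor power of the Banach space $A$. For $\mu=(m_1,\dots,m_k)$ and $\nu=(n_1,\dots,n_\ell)$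 in $S$ let $\Sigma_\mu\times\Sigma_\nu\to\Sigma_{\mu\cdot\nu}$ be the bounded bilinear map given on elementary tensors by $$(a_1\otimes\cdots\otimes a_k)\cdot(b_1\otimes\cdots\otimes b_\ell)=\begin{cases}a_1\otimes\cdots\otimes a_k\otimes b_1\otimes\cdots\otimes b_\ell,& m_k\ne n_1,\\ a_1\otimes\cdots\otimes a_{k-1}\otimes a_kb_1\otimes b_2\otimes\cdots\otimes b_\ell,& m_k=n_1,\end{cases}$$ and let $\Sigma_\mu\to\Sigma_{\mu^*}$ be the antilinear isometry with $(a_1\otimes\cdots\otimes a_k)^*=a_k^*\otimes\cdots\otimes a_1^*$. Let $\ell^1(\Sigma)$ be the Banach $*$-algebra of all functions $f$ on $S$ with $f(\mu)\in\Sigma_\mu$ for all $\mu$ and $\|f\|=\sum_{\mu\in S}\|f(\mu)\|<\infty$, with $(f*g)(\nu)=\sum_{\lambda\cdot\mu=\nu}f(\lambda)\cdot g(\mu)$ and $f^*(\mu)=f(\mu^*)^*$. For $k\ge0$ let $\theta_k:A\to\ell^1(\Sigma)$ be the $*$-homomorphism for which $\theta_k(a)=\delta_{(k)}\cdot a$ is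 the function with value $a$ at the one-term sequence $(k)$ and $0$ elsewhere. Let $C^*(\ell^1(\Sigma))$ be the enveloping $C^*$-algebra, that is, the Hausdorff completion of $\ell^1(\Sigma)$ in the seminorm $\sup_\pi\|\pi(f)\|$, where $\pi$ runs over the $*$-representations of $\ell^1(\Sigma)$ on Hilbert spaces, and let $\tilde\theta_k:A\to C^*(\ell^1(\Sigma))$ be $\theta_k$ followed by the canonical map. **Proposition.** $C^*(\ell^1(\Sigma))$ with the sequence $\tilde\theta_0,\tilde\theta_1,\dots$ is an infinite free product of copies of $A$: it is generated by $\bigcup_k\tilde\theta_k(A)$, and for every $C^*$-algebra $D$ and all $*$-homomorphisms $\pi_k:A\to D$, $k\ge0$, there is a unique $*$-homomorphism $\rho:C^*(\ell^1(\Sigma))\to D$ with $\rho\circ\tilde\theta_k=\pi_k$ for all $k$. Consequently it is isomorphic to $\mathcal P A$: for every infinite free product $(P,\theta^P_0,\theta^P_1,\dots)$ of copies of $A$ there is a unique $*$-isomorphism $e:C^*(\ell^1(\Sigma))\to P$ with $e\circ\tilde\theta_k=\theta^P_k$ for all $k\ge 0$. -/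

import Mathlib

universe u v w

noncomputable section

/-- Banach `*`-algebras over `ℂ`, with isometric involution. -/
class BanachStarAlgebra (B : Type*) extends NonUnitalNormedRing B, StarRing B, CompleteSpace B,
    NormedSpace ℂ B, IsScalarTower ℂ B B, SMulCommClass ℂ B B, StarModule ℂ B, NormedStarGroup B

/-! ### The enveloping C⋆-algebra of a Banach `*`-algebra -/

namespace BanachStarAlgebra

/-- A `*`-representation of `B` by bounded operators on a Hilbert space. -/
structure HilbertRep (B : Type u) [BanachStarAlgebra B] where
  /-- The Hilbert space. -/
  H : Type u
  [normed : NormedAddCommGroup H]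
  [inner : InnerProductSpace ℂ H]
  [complete : CompleteSpace H]
  /-- The action. -/
  π : B →⋆ₙₐ[ℂ] (H →L[ℂ] H)

attribute [instance] HilbertRep.normed HilbertRep.inner HilbertRep.complete

/-- A `*`-homomorphism from a Banach `*`-algebra to a C⋆-algebra is contractive. -/
theorem norm_map_le {B : Type*} [BanachStarAlgebra B] {C : Type*} [CStarAlgebra C]
    (π : B →⋆ₙₐ[ℂ] C) (x : B) : ‖π x‖ ≤ ‖x‖ := by
  have key : ∀ h : B, IsSelfAdjoint h → ‖π h‖ ≤ ‖h‖ := by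
    intro h hh
    let D := WithLp 1 (Unitization ℂ B)
    let ψ : D →ₐ[ℂ] C :=
      (Unitization.lift (π : B →ₙₐ[ℂ] C)).comp
        (WithLp.unitizationAlgEquiv ℂ : D ≃ₐ[ℂ] Unitization ℂ B).toAlgHom
    let d : D := WithLp.toLp 1 (h : Unitization ℂ B)
    have hψ : ψ d = π h := by
      change Unitization.lift (π : B →ₙₐ[ℂ] C) (h : Unitization ℂ B) = π h
      simp
      rfl
    have h1 : NormOneClass D := ⟨by
      rw [WithLp.unitization_norm_def]
      have : (WithLp.ofLp (1 : D)) = (1 : Unitization ℂ B) := rfl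
      rw [this]; simp⟩
    have hs : spectralRadius ℂ (ψ d) ≤ spectralRadius ℂ d :=
      iSup_le_iSup_of_subset (AlgHom.spectrum_apply_subset ψ d)
    rw [hψ, (hh.map π).spectralRadius_eq_nnnorm] at hs
    have h2 := hs.trans (spectrum.spectralRadius_le_nnnorm d)
    have h3 : ‖π h‖₊ ≤ ‖d‖₊ := by exact_mod_cast h2
    have h4 : ‖π h‖ ≤ ‖d‖ := by exact_mod_cast h3
    rwa [show ‖d‖ = ‖h‖ from WithLp.unitization_norm_inr h] at h4
  have h := key (star x * x) (IsSelfAdjoint.star_mul_self x)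
  rw [map_mul, map_star, CStarRing.norm_star_mul_self] at h
  have h' : ‖star x * x‖ ≤ ‖x‖ * ‖x‖ := (norm_mul_le _ _).trans (by rw [norm_star])
  exact (mul_self_le_mul_self_iff (norm_nonneg _) (norm_nonneg x)).2 (h.trans h')

/-- The enveloping C⋆-seminorm: `sup ‖π x‖` over all `*`-representations `π` on Hilbert spaces. -/
def envNorm {B : Type u} [BanachStarAlgebra B] (x : B) : ℝ := ⨆ r : HilbertRep B, ‖r.π x‖

section envNorm

variable {B : Type u} [BanachStarAlgebra B]

theorem le_envNorm (r : HilbertRep B) (x : B) : ‖r.π x‖ ≤ envNorm x :=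
  le_ciSup (f := fun r : HilbertRep B => ‖r.π x‖)
    ⟨‖x‖, by rintro _ ⟨r, rfl⟩; exact norm_map_le r.π x⟩ r

theorem envNorm_nonneg (x : B) : 0 ≤ envNorm x := Real.iSup_nonneg fun _ => norm_nonneg _

theorem envNorm_le {x : B} {c : ℝ} (hc : 0 ≤ c) (h : ∀ r : HilbertRep B, ‖r.π x‖ ≤ c) :
    envNorm x ≤ c := Real.iSup_le h hc

theorem envNorm_le_norm (x : B) : envNorm x ≤ ‖x‖ :=
  envNorm_le (norm_nonneg x) fun r => norm_map_le r.π x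

theorem envNorm_zero : envNorm (0 : B) = 0 :=
  le_antisymm (envNorm_le le_rfl fun r => by simp) (envNorm_nonneg _)

theorem envNorm_add (x y : B) : envNorm (x + y) ≤ envNorm x + envNorm y :=
  envNorm_le (add_nonneg (envNorm_nonneg x) (envNorm_nonneg y)) fun r => by
    rw [map_add]
    exact (norm_add_le _ _).trans (add_le_add (le_envNorm r x) (le_envNorm r y))

theorem envNorm_mul (x y : B) : envNorm (x * y) ≤ envNorm x * envNorm y :=
  envNorm_le (mul_nonneg (envNorm_nonneg x) (envNorm_nonneg y)) fun r => by
    rw [map_mul]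
    exact (norm_mul_le _ _).trans
      (mul_le_mul (le_envNorm r x) (le_envNorm r y) (norm_nonneg _) (envNorm_nonneg x))

theorem envNorm_smul (c : ℂ) (x : B) : envNorm (c • x) ≤ ‖c‖ * envNorm x :=
  envNorm_le (mul_nonneg (norm_nonneg c) (envNorm_nonneg x)) fun r => by
    rw [map_smul, norm_smul]
    exact mul_le_mul_of_nonneg_left (le_envNorm r x) (norm_nonneg c)

theorem envNorm_star (x : B) : envNorm (star x) ≤ envNorm x :=
  envNorm_le (envNorm_nonneg x) fun r => by
    rw [map_star, norm_star]
    exact le_envNorm r x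

theorem envNorm_neg (x : B) : envNorm (-x) = envNorm x := by simp [envNorm]

theorem envNorm_mul_self_le (x : B) : envNorm x * envNorm x ≤ envNorm (star x * x) := by
  have h : envNorm x ≤ √(envNorm (star x * x)) := envNorm_le (Real.sqrt_nonneg _) fun r => by
    refine Real.le_sqrt_of_sq_le ?_
    have := le_envNorm r (star x * x)
    rwa [map_mul, map_star, CStarRing.norm_star_mul_self, ← sq] at this
  calc _ ≤ √(envNorm (star x * x)) * √(envNorm (star x * x)) :=
        mul_le_mul h h (envNorm_nonneg x) (Real.sqrt_nonneg _)
    _ = _ := Real.mul_self_sqrt (envNorm_nonneg _)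

end envNorm

/-- A copy of `B`, to carry the enveloping C⋆-seminorm instead of the norm of `B`. -/
def PreEnvelope (B : Type u) : Type u := B

namespace PreEnvelope

variable (B : Type u) [BanachStarAlgebra B]

instance : NonUnitalRing (PreEnvelope B) := inferInstanceAs (NonUnitalRing B)
instance : StarRing (PreEnvelope B) := inferInstanceAs (StarRing B)
instance : Module ℂ (PreEnvelope B) := inferInstanceAs (Module ℂ B)
instance : IsScalarTower ℂ (PreEnvelope B) (PreEnvelope B) :=
  inferInstanceAs (IsScalarTower ℂ B B)
instance : SMulCommClass ℂ (PreEnvelope B) (PreEnvelope B) :=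
  inferInstanceAs (SMulCommClass ℂ B B)
instance : StarModule ℂ (PreEnvelope B) := inferInstanceAs (StarModule ℂ B)

instance : SeminormedAddCommGroup (PreEnvelope B) :=
  AddGroupSeminorm.toSeminormedAddCommGroup
    { toFun := fun x : PreEnvelope B => envNorm (B := B) x
      map_zero' := envNorm_zero (B := B)
      add_le' := envNorm_add (B := B)
      neg' := envNorm_neg (B := B) }

instance : NonUnitalSeminormedRing (PreEnvelope B) :=
  { (inferInstance : SeminormedAddCommGroup (PreEnvelope B)),
    (inferInstance : NonUnitalRing (PreEnvelope B)) with
    norm_mul_le := envNorm_mul (B := B) }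

instance : NormedSpace ℂ (PreEnvelope B) where
  norm_smul_le := envNorm_smul (B := B)

instance : NormedStarGroup (PreEnvelope B) where
  norm_star_le := envNorm_star (B := B)

theorem norm_def (x : PreEnvelope B) : ‖x‖ = envNorm (B := B) x := rfl

end PreEnvelope

/-- The enveloping C⋆-algebra `C⋆(B)`: the Hausdorff completion of `B` in the enveloping
C⋆-seminorm. -/
def CStarEnvelope (B : Type u) [BanachStarAlgebra B] : Type u :=
  UniformSpace.Completion (PreEnvelope B)

namespace CStarEnvelope

open UniformSpace UniformSpace.Completion

variable (B : Type u) [BanachStarAlgebra B]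

instance : NormedAddCommGroup (CStarEnvelope B) :=
  inferInstanceAs (NormedAddCommGroup (Completion (PreEnvelope B)))
instance : NormedSpace ℂ (CStarEnvelope B) :=
  inferInstanceAs (NormedSpace ℂ (Completion (PreEnvelope B)))
instance : CompleteSpace (CStarEnvelope B) :=
  inferInstanceAs (CompleteSpace (Completion (PreEnvelope B)))

variable {B}

/-- The completion map `B → C⋆(B)`. -/
def coe (x : B) : CStarEnvelope B := ((show PreEnvelope B from x : PreEnvelope B) :
  Completion (PreEnvelope B))

theorem norm_coe (x : B) : ‖coe x‖ = envNorm x :=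
  UniformSpace.Completion.norm_coe (E := PreEnvelope B) x

theorem coe_add (x y : B) : coe (x + y) = coe x + coe y :=
  UniformSpace.Completion.coe_add (α := PreEnvelope B) x y

theorem coe_zero : coe (0 : B) = 0 :=
  UniformSpace.Completion.coe_zero (α := PreEnvelope B)

theorem coe_smul (c : ℂ) (x : B) : coe (c • x) = c • coe x :=
  UniformSpace.Completion.coe_smul (M := ℂ) (X := PreEnvelope B) c x

theorem denseRange_coe : DenseRange (coe : B → CStarEnvelope B) :=
  UniformSpace.Completion.denseRange_coe (α := PreEnvelope B)

@[elab_as_elim]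
theorem induction_on {p : CStarEnvelope B → Prop} (x : CStarEnvelope B)
    (hp : IsClosed {x | p x}) (ih : ∀ b : B, p (coe b)) : p x :=
  isClosed_property denseRange_coe hp ih x

/-- Multiplication is the continuous extension of that of `B`. -/
instance : Mul (CStarEnvelope B) :=
  ⟨Function.curry <| ((isDenseInducing_coe (α := PreEnvelope B)).prodMap
    (isDenseInducing_coe (α := PreEnvelope B))).extend
      (fun p : PreEnvelope B × PreEnvelope B => ((p.1 * p.2 : PreEnvelope B) :
        Completion (PreEnvelope B)))⟩

theorem coe_mul (x y : B) : coe (x * y) = coe x * coe y :=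
  (((isDenseInducing_coe (α := PreEnvelope B)).prodMap
    (isDenseInducing_coe (α := PreEnvelope B))).extend_eq
      ((continuous_coe (PreEnvelope B)).comp (@continuous_mul (PreEnvelope B) _ _ _)) (x, y)).symm

instance : ContinuousMul (CStarEnvelope B) where
  continuous_mul := by
    let m := (AddMonoidHom.mul : PreEnvelope B →+ PreEnvelope B →+ PreEnvelope B).compr₂ toCompl
    have : Continuous fun p : PreEnvelope B × PreEnvelope B => m p.1 p.2 :=
      (continuous_coe (PreEnvelope B)).comp continuous_mul
    have di : IsDenseInducing (toCompl : PreEnvelope B → Completion (PreEnvelope B)) :=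
      isDenseInducing_coe
    exact (di.extend_Z_bilin di this :)

/-- The involution is the continuous extension of that of `B`. -/
instance : Star (CStarEnvelope B) :=
  ⟨Completion.map (star : PreEnvelope B → PreEnvelope B)⟩

theorem uniformContinuous_star : UniformContinuous (star : PreEnvelope B → PreEnvelope B) :=
  (starNormedAddGroupHom (E := PreEnvelope B)).uniformContinuous

theorem coe_star (x : B) : coe (star x) = star (coe x) :=
  (Completion.map_coe (uniformContinuous_star (B := B)) _).symm

theorem continuous_star' : Continuous (star : CStarEnvelope B → CStarEnvelope B) :=
  Completion.continuous_map

section laws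

theorem zero_mul' : ∀ a : CStarEnvelope B, 0 * a = 0 := by
  refine isClosed_property denseRange_coe ?_ fun a => ?_
  · exact isClosed_eq (by fun_prop) (by fun_prop)
  · rw [← coe_zero, ← coe_mul, zero_mul]

theorem mul_zero' : ∀ a : CStarEnvelope B, a * 0 = 0 := by
  refine isClosed_property denseRange_coe ?_ fun a => ?_
  · exact isClosed_eq (by fun_prop) (by fun_prop)
  · rw [← coe_zero, ← coe_mul, mul_zero]

theorem mul_assoc' : ∀ a b c : CStarEnvelope B, a * b * c = a * (b * c) := by
  refine isClosed_property3 denseRange_coe ?_ fun a b c => ?_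
  · exact isClosed_eq (by fun_prop) (by fun_prop)
  · simp only [← coe_mul, mul_assoc]

theorem mul_add' : ∀ a b c : CStarEnvelope B, a * (b + c) = a * b + a * c := by
  refine isClosed_property3 denseRange_coe ?_ fun a b c => ?_
  · exact isClosed_eq (by fun_prop) (by fun_prop)
  · simp only [← coe_mul, ← coe_add, mul_add]

theorem add_mul' : ∀ a b c : CStarEnvelope B, (a + b) * c = a * c + b * c := by
  refine isClosed_property3 denseRange_coe ?_ fun a b c => ?_
  · exact isClosed_eq (by fun_prop) (by fun_prop)
  · simp only [← coe_mul, ← coe_add, add_mul]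

theorem norm_mul_le' : ∀ a b : CStarEnvelope B, ‖a * b‖ ≤ ‖a‖ * ‖b‖ := by
  refine isClosed_property2 denseRange_coe ?_ fun a b => ?_
  · exact isClosed_le (by fun_prop) (by fun_prop)
  · rw [← coe_mul, norm_coe, norm_coe, norm_coe]
    exact envNorm_mul a b

theorem star_star' : ∀ a : CStarEnvelope B, star (star a) = a := by
  refine isClosed_property denseRange_coe ?_ fun a => ?_
  · exact isClosed_eq (continuous_star'.comp continuous_star') continuous_id
  · rw [← coe_star, ← coe_star, star_star]

theorem star_mul' : ∀ a b : CStarEnvelope B, star (a * b) = star b * star a := by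
  refine isClosed_property2 denseRange_coe ?_ fun a b => ?_
  · exact isClosed_eq (continuous_star'.comp continuous_mul)
      ((continuous_star'.comp continuous_snd).mul (continuous_star'.comp continuous_fst))
  · rw [← coe_mul, ← coe_star, star_mul, coe_mul, coe_star, coe_star]

theorem star_add' : ∀ a b : CStarEnvelope B, star (a + b) = star a + star b := by
  refine isClosed_property2 denseRange_coe ?_ fun a b => ?_
  · exact isClosed_eq (continuous_star'.comp continuous_add)
      ((continuous_star'.comp continuous_fst).add (continuous_star'.comp continuous_snd))
  · rw [← coe_add, ← coe_star, star_add, coe_add, coe_star, coe_star]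

theorem norm_mul_self' : ∀ a : CStarEnvelope B, ‖a‖ * ‖a‖ ≤ ‖star a * a‖ := by
  refine isClosed_property denseRange_coe ?_ fun a => ?_
  · exact isClosed_le (by fun_prop) (continuous_star'.mul continuous_id).norm
  · rw [← coe_star, ← coe_mul, norm_coe, norm_coe]
    exact envNorm_mul_self_le a

theorem smul_mul' (c : ℂ) : ∀ a b : CStarEnvelope B, (c • a) * b = c • (a * b) := by
  refine isClosed_property2 denseRange_coe ?_ fun a b => ?_
  · exact isClosed_eq ((continuous_fst.const_smul c).mul continuous_snd)
      ((continuous_fst.mul continuous_snd).const_smul c)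
  · simp only [← coe_smul, ← coe_mul, smul_mul_assoc]

theorem mul_smul' (c : ℂ) : ∀ a b : CStarEnvelope B, c • (a * b) = a * (c • b) := by
  refine isClosed_property2 denseRange_coe ?_ fun a b => ?_
  · exact isClosed_eq ((continuous_fst.mul continuous_snd).const_smul c)
      (continuous_fst.mul (continuous_snd.const_smul c))
  · simp only [← coe_smul, ← coe_mul, mul_smul_comm]

theorem star_smul' (c : ℂ) : ∀ a : CStarEnvelope B, star (c • a) = star c • star a := by
  refine isClosed_property denseRange_coe ?_ fun a => ?_
  · exact isClosed_eq (continuous_star'.comp (continuous_const_smul c))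
      (continuous_star'.const_smul (star c))
  · rw [← coe_smul, ← coe_star, star_smul, coe_smul, coe_star]

end laws

instance : NonUnitalNormedRing (CStarEnvelope B) :=
  { (inferInstance : NormedAddCommGroup (CStarEnvelope B)),
    (inferInstance : Mul (CStarEnvelope B)) with
    zero_mul := zero_mul'
    mul_zero := mul_zero'
    mul_assoc := mul_assoc'
    left_distrib := mul_add'
    right_distrib := add_mul'
    norm_mul_le := norm_mul_le' }

instance : StarRing (CStarEnvelope B) where
  star_involutive := star_star'
  star_mul := star_mul'
  star_add := star_add'

instance : NonUnitalCStarAlgebra (CStarEnvelope B) where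
  norm_mul_self_le := norm_mul_self'
  smul_assoc := smul_mul'
  smul_comm := mul_smul'
  star_smul := star_smul'

variable (B) in
/-- The canonical `*`-homomorphism `B → C⋆(B)`. -/
def of : B →⋆ₙₐ[ℂ] CStarEnvelope B where
  toFun := coe
  map_smul' := coe_smul
  map_zero' := coe_zero
  map_add' := coe_add
  map_mul' := coe_mul
  map_star' := coe_star

end CStarEnvelope

end BanachStarAlgebra

end

/-! ### The index semigroup `S` -/

/-- Nonempty finite sequences of nonnegative integers with distinct neighbours. -/
@[ext]
structure AltSeq where
  /-- The underlying list. -/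
  val : List ℕ
  ne_nil : val ≠ []
  chain : val.IsChain (· ≠ ·)

namespace AltSeq

instance : DecidableEq AltSeq := fun μ ν => decidable_of_iff (μ.val = ν.val) (AltSeq.ext_iff).symm

/-- The length of a sequence. -/
def length (μ : AltSeq) : ℕ := μ.val.length

theorem length_pos (μ : AltSeq) : 0 < μ.length := List.length_pos_of_ne_nil μ.ne_nil

/-- The last term. -/
def last (μ : AltSeq) : ℕ := μ.val.getLast μ.ne_nil

/-- The first term. -/
def first (μ : AltSeq) : ℕ := μ.val.head μ.ne_nil

/-- Conditional concatenation: `(m₁,…,mₖ)·(n₁,…,nₗ)` is `(m₁,…,mₖ,n₂,…,nₗ)` if `mₖ = n₁` and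
`(m₁,…,mₖ,n₁,…,nₗ)` otherwise. -/
instance : Mul AltSeq where
  mul μ ν :=
    { val := if μ.last = ν.first then μ.val ++ ν.val.tail else μ.val ++ ν.val
      ne_nil := by
        have := μ.ne_nil
        split <;> simp [this]
      chain := by
        have hμ := μ.chain
        have hν := ν.chain
        split
        · rename_i h
          refine hμ.append hν.tail ?_
          intro x hx z hz
          rw [List.getLast?_eq_getLast_of_ne_nil μ.ne_nil, Option.mem_some_iff] at hx
          change μ.val.getLast μ.ne_nil = ν.val.head ν.ne_nil at h
          rw [hx] at h
          obtain ⟨n, hn, _⟩ := ν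
          match n, hn with
          | [y], _ => simp at hz
          | y :: z' :: zs, _ =>
            simp only [List.tail_cons, List.head?_cons, Option.mem_some_iff] at hz
            simp only [List.head_cons] at h
            rw [h, ← hz]
            exact (List.isChain_cons_cons.1 hν).1
        · rename_i h
          refine hμ.append hν ?_
          intro x hx z hz
          rw [List.getLast?_eq_getLast_of_ne_nil μ.ne_nil, Option.mem_some_iff] at hx
          rw [List.head?_eq_some_head ν.ne_nil, Option.mem_some_iff] at hz
          rw [← hx, ← hz]
          exact h }

/-- Reversal of sequences. -/
instance : Star AltSeq where
  star μ :=
    { val := μ.val.reverse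
      ne_nil := by simpa using μ.ne_nil
      chain := by
        rw [List.isChain_reverse]
        exact μ.chain.imp fun _ _ h => h.symm }

theorem val_mul (μ ν : AltSeq) : (μ * ν).val =
    if μ.last = ν.first then μ.val ++ ν.val.tail else μ.val ++ ν.val := rfl

theorem val_star (μ : AltSeq) : (star μ).val = μ.val.reverse := rfl

instance : InvolutiveStar AltSeq where
  star_involutive μ := AltSeq.ext (by simp [val_star])

theorem length_star (μ : AltSeq) : (star μ).length = μ.length := by
  simp [length, val_star]

theorem length_mul_of_eq {μ ν : AltSeq} (h : μ.last = ν.first) :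
    (μ * ν).length + 1 = μ.length + ν.length := by
  have := ν.length_pos
  simp only [length] at this
  simp [length, val_mul, h]
  omega

theorem length_mul_of_ne {μ ν : AltSeq} (h : μ.last ≠ ν.first) :
    (μ * ν).length = μ.length + ν.length := by
  simp [length, val_mul, h]

/-- The sequence `(k)` of length one. -/
def single (k : ℕ) : AltSeq := ⟨[k], by simp, by simp⟩

end AltSeq

set_option linter.unusedSectionVars false

noncomputable section

/-! ### The fibres: projective tensor powers -/

open scoped TensorProduct

section Fibres

variable (A : Type u) [NonUnitalCStarAlgebra A]

/-- The `n`-fold projective tensor power of `A`: the Hausdorff completion of the algebraic tensor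
power in the projective seminorm (which Mathlib puts on `PiTensorProduct`). -/
def ProjPower (n : ℕ) : Type u := UniformSpace.Completion (⨂[ℂ] _ : Fin n, A)

namespace ProjPower

instance (n : ℕ) : NormedAddCommGroup (ProjPower A n) :=
  inferInstanceAs (NormedAddCommGroup (UniformSpace.Completion (⨂[ℂ] _ : Fin n, A)))
instance (n : ℕ) : NormedSpace ℂ (ProjPower A n) :=
  inferInstanceAs (NormedSpace ℂ (UniformSpace.Completion (⨂[ℂ] _ : Fin n, A)))
instance (n : ℕ) : CompleteSpace (ProjPower A n) :=
  inferInstanceAs (CompleteSpace (UniformSpace.Completion (⨂[ℂ] _ : Fin n, A)))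

/-- The completion map. -/
def mk (n : ℕ) : (⨂[ℂ] _ : Fin n, A) →ₗᵢ[ℂ] ProjPower A n :=
  UniformSpace.Completion.toComplₗᵢ (𝕜 := ℂ) (E := ⨂[ℂ] _ : Fin n, A)

variable {A}

theorem denseRange_mk {n : ℕ} : DenseRange (mk A n) :=
  UniformSpace.Completion.denseRange_coe (α := ⨂[ℂ] _ : Fin n, A)

/-- The elementary tensor `a₁ ⊗ ⋯ ⊗ aₙ`. -/
def tensor {n : ℕ} (a : Fin n → A) : ProjPower A n := mk A n (PiTensorProduct.tprod ℂ a)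

theorem norm_tensor_le {n : ℕ} (a : Fin n → A) : ‖tensor a‖ ≤ ∏ i, ‖a i‖ := by
  rw [tensor, LinearIsometry.norm_map]
  exact PiTensorProduct.projectiveSeminorm_tprod_le a

/-- The elementary tensors span a dense subspace. -/
theorem induction_on {n : ℕ} {p : ProjPower A n → Prop} (hc : IsClosed {x | p x})
    (hs : ∀ (c : ℂ) (a : Fin n → A), p (c • tensor a)) (ha : ∀ x y, p x → p y → p (x + y))
    (x : ProjPower A n) : p x := by
  refine isClosed_property denseRange_mk hc (fun t => ?_) x
  induction t using PiTensorProduct.induction_on with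
  | smul_tprod r f =>
    rw [map_smul]
    exact hs r f
  | add x y hx hy =>
    rw [map_add]
    exact ha _ _ hx hy

variable {F : Type v} [NormedAddCommGroup F] [NormedSpace ℂ F] [CompleteSpace F]

/-- The extension of a bounded multilinear map to the projective tensor power. -/
def liftFun {n : ℕ} (f : ContinuousMultilinearMap ℂ (fun _ : Fin n => A) F) :
    ProjPower A n →L[ℂ] F :=
  (PiTensorProduct.lift f.toMultilinearMap).extendOfNorm (mk A n).toLinearMap

theorem norm_lift_le_mk {n : ℕ} (f : ContinuousMultilinearMap ℂ (fun _ : Fin n => A) F)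
    (x : ⨂[ℂ] _ : Fin n, A) :
    ‖PiTensorProduct.lift f.toMultilinearMap x‖ ≤ ‖f‖ * ‖(mk A n).toLinearMap x‖ := by
  refine (PiTensorProduct.norm_eval_le_projectiveSeminorm f x).trans_eq ?_
  exact congrArg (‖f‖ * ·) ((mk A n).norm_map x).symm

theorem liftFun_tensor {n : ℕ} (f : ContinuousMultilinearMap ℂ (fun _ : Fin n => A) F)
    (a : Fin n → A) : liftFun f (tensor a) = f a := by
  have := LinearMap.extendOfNorm_eq (f := PiTensorProduct.lift f.toMultilinearMap)
    (e := (mk A n).toLinearMap) denseRange_mk ⟨_, norm_lift_le_mk f⟩ (PiTensorProduct.tprod ℂ a)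
  rw [PiTensorProduct.lift.tprod] at this
  exact this

theorem norm_liftFun_apply_le {n : ℕ} (f : ContinuousMultilinearMap ℂ (fun _ : Fin n => A) F)
    (x : ProjPower A n) : ‖liftFun f x‖ ≤ ‖f‖ * ‖x‖ :=
  LinearMap.norm_extendOfNorm_apply_le denseRange_mk _ (norm_lift_le_mk f) x

theorem hom_ext {n : ℕ} {S T : ProjPower A n →L[ℂ] F}
    (h : ∀ a : Fin n → A, S (tensor a) = T (tensor a)) : S = T := by
  ext x
  refine induction_on (isClosed_eq S.continuous T.continuous) (fun c a => ?_)
    (fun x y hx hy => ?_) x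
  · rw [map_smul, map_smul, h]
  · rw [map_add, map_add, hx, hy]

theorem liftFun_add {n : ℕ} (f g : ContinuousMultilinearMap ℂ (fun _ : Fin n => A) F) :
    liftFun (f + g) = liftFun f + liftFun g := hom_ext fun a => by
  rw [add_apply, liftFun_tensor, liftFun_tensor, liftFun_tensor]
  rfl

theorem liftFun_smul {n : ℕ} (c : ℂ) (f : ContinuousMultilinearMap ℂ (fun _ : Fin n => A) F) :
    liftFun (c • f) = c • liftFun f := hom_ext fun a => by
  rw [smul_apply, liftFun_tensor, liftFun_tensor]
  rfl

/-- The universal property of the projective tensor power, as a bounded linear map. -/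
def lift {n : ℕ} :
    ContinuousMultilinearMap ℂ (fun _ : Fin n => A) F →L[ℂ] (ProjPower A n →L[ℂ] F) :=
  LinearMap.mkContinuous
    { toFun := liftFun
      map_add' := liftFun_add
      map_smul' := fun c f => by
        rw [RingHom.id_apply]
        exact liftFun_smul c f }
    1 fun f => by
      rw [one_mul]
      exact ContinuousLinearMap.opNorm_le_bound _ (norm_nonneg f) (norm_liftFun_apply_le f)

theorem lift_tensor {n : ℕ} (f : ContinuousMultilinearMap ℂ (fun _ : Fin n => A) F)
    (a : Fin n → A) : lift f (tensor a) = f a := liftFun_tensor f a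

theorem norm_lift_apply_le {n : ℕ} (f : ContinuousMultilinearMap ℂ (fun _ : Fin n => A) F)
    (x : ProjPower A n) : ‖lift f x‖ ≤ ‖f‖ * ‖x‖ := norm_liftFun_apply_le f x

theorem norm_lift_le {n : ℕ} (f : ContinuousMultilinearMap ℂ (fun _ : Fin n => A) F) :
    ‖lift f‖ ≤ ‖f‖ :=
  ContinuousLinearMap.opNorm_le_bound _ (norm_nonneg f) (norm_liftFun_apply_le f)

end ProjPower

/-! ### Fibrewise multiplication -/

variable {A} (μ ν : AltSeq)

/-- The tuple of the product of two elementary tensors: concatenation if `mₖ ≠ n₁`, and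
`(a₁, …, aₖ₋₁, aₖ b₁, b₂, …, bₗ)` if `mₖ = n₁`. -/
def mulTuple (a : Fin μ.length → A) (b : Fin ν.length → A) : Fin (μ * ν).length → A :=
  if h : μ.last = ν.first then fun i =>
    if h₁ : i.1 + 1 < μ.length then a ⟨i, by omega⟩
    else if i.1 + 1 = μ.length then
      a ⟨μ.length - 1, by have := μ.length_pos; omega⟩ * b ⟨0, ν.length_pos⟩
    else b ⟨i + 1 - μ.length, by have := AltSeq.length_mul_of_eq h; omega⟩
  else fun i =>
    if h₁ : i.1 < μ.length then a ⟨i, h₁⟩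
    else b ⟨i - μ.length, by have := AltSeq.length_mul_of_ne h; omega⟩

theorem AltSeq.le_length_mul_left : μ.length ≤ (μ * ν).length := by
  have := ν.length_pos
  by_cases h : μ.last = ν.first
  · have := length_mul_of_eq h; omega
  · have := length_mul_of_ne h; omega

/-- Position in the product of the `j`-th entry of the second factor. -/
def AltSeq.rightPos (j : Fin ν.length) : Fin (μ * ν).length :=
  ⟨if μ.last = ν.first then j + μ.length - 1 else j + μ.length, by
    have := μ.length_pos
    split
    · rename_i h; have := length_mul_of_eq h; omega
    · rename_i h; have := length_mul_of_ne h; omega⟩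

theorem mulTuple_update_left [DecidableEq (Fin μ.length)] (a : Fin μ.length → A)
    (b : Fin ν.length → A) (j : Fin μ.length) (x : A) :
    mulTuple μ ν (Function.update a j x) b =
      Function.update (mulTuple μ ν a b) (Fin.castLE (AltSeq.le_length_mul_left μ ν) j)
        (if μ.last = ν.first ∧ j.1 + 1 = μ.length then x * b ⟨0, ν.length_pos⟩ else x) := by
  funext i
  have := j.2
  by_cases h : μ.last = ν.first
  · by_cases hj : j.1 + 1 = μ.length
    · simp only [mulTuple, h, Function.update_apply, Fin.ext_iff, Fin.val_castLE]
      grind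
    · simp only [mulTuple, h, Function.update_apply, Fin.ext_iff, Fin.val_castLE]
      grind
  · simp only [mulTuple, h, Function.update_apply, Fin.ext_iff, Fin.val_castLE]
    grind

theorem mulTuple_update_right [DecidableEq (Fin ν.length)] (a : Fin μ.length → A)
    (b : Fin ν.length → A) (j : Fin ν.length) (x : A) :
    mulTuple μ ν a (Function.update b j x) =
      Function.update (mulTuple μ ν a b) (AltSeq.rightPos μ ν j)
        (if μ.last = ν.first ∧ j.1 = 0 then
          a ⟨μ.length - 1, by have := μ.length_pos; omega⟩ * x else x) := by
  funext i
  have := μ.length_pos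
  by_cases h : μ.last = ν.first
  · by_cases hj : j.1 = 0
    · simp only [mulTuple, h, AltSeq.rightPos, Function.update_apply, Fin.ext_iff]
      grind
    · simp only [mulTuple, h, AltSeq.rightPos, Function.update_apply, Fin.ext_iff]
      grind
  · simp only [mulTuple, h, AltSeq.rightPos, Function.update_apply, Fin.ext_iff]
    grind

/-- The list of pairs `((n₁, a₁), …, (nₖ, aₖ))` that stands for `δ_ν · a₁ ⊗ ⋯ ⊗ aₖ`. -/
def word (a : Fin μ.length → A) : List (ℕ × A) :=
  List.ofFn fun i : Fin μ.length => (μ.val[i.1]'i.2, a i)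

/-- Multiplication of nonempty words. -/
def wordMul : List (ℕ × A) → List (ℕ × A) → List (ℕ × A)
  | [], v => v
  | [x], [] => [x]
  | [x], y :: ys => if x.1 = y.1 then (x.1, x.2 * y.2) :: ys else x :: y :: ys
  | x :: x' :: xs, v => x :: wordMul (x' :: xs) v

theorem wordMul_ne_nil : ∀ (u v : List (ℕ × A)), u ≠ [] → wordMul u v ≠ []
  | [], _, h => absurd rfl h
  | [x], [], _ => by simp [wordMul]
  | [x], y :: ys, _ => by rw [wordMul]; split <;> simp
  | x :: x' :: xs, v, _ => by simp [wordMul]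

theorem wordMul_cons (x : ℕ × A) (u v : List (ℕ × A)) (h : u ≠ []) :
    wordMul (x :: u) v = x :: wordMul u v := by
  cases u with
  | nil => exact absurd rfl h
  | cons y ys => rw [wordMul]

theorem wordMul_assoc : ∀ (u v w : List (ℕ × A)), v ≠ [] →
    wordMul (wordMul u v) w = wordMul u (wordMul v w)
  | [], v, w, _ => by simp [wordMul]
  | [x], [], w, h => absurd rfl h
  | [x], [y], [], _ => by
    by_cases h : x.1 = y.1 <;> simp [wordMul, h]
  | [x], [y], z :: zs, _ => by
    by_cases h : x.1 = y.1 <;> by_cases h' : y.1 = z.1 <;> grind [wordMul, mul_assoc]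
  | [x], y :: y' :: ys, w, _ => by
    by_cases h : x.1 = y.1 <;> simp [wordMul, h]
  | x :: x' :: xs, v, w, h => by
    rw [wordMul, wordMul, wordMul_cons _ _ _ (wordMul_ne_nil _ _ (by simp)),
      wordMul_assoc (x' :: xs) v w h]

theorem wordMul_eq : ∀ (u v : List (ℕ × A)) (hu : u ≠ []) (hv : v ≠ []),
    wordMul u v = if (u.getLast hu).1 = (v.head hv).1 then
      u.dropLast ++ ((u.getLast hu).1, (u.getLast hu).2 * (v.head hv).2) :: v.tail else u ++ v
  | [], _, h, _ => absurd rfl h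
  | [x], [], _, h => absurd rfl h
  | [x], y :: ys, _, _ => by simp [wordMul]
  | x :: x' :: xs, v, hu, hv => by
    rw [wordMul, wordMul_eq (x' :: xs) v (by simp) hv]
    simp only [List.getLast_cons_cons, List.dropLast_cons_cons]
    split_ifs <;> rfl

theorem wordMul_norm_le : ∀ (u v : List (ℕ × A)),
    ((wordMul u v).map fun p => ‖p.2‖).prod ≤
      (u.map fun p => ‖p.2‖).prod * (v.map fun p => ‖p.2‖).prod
  | [], _ => by simp [wordMul]
  | [x], [] => by simp [wordMul]
  | [x], y :: ys => by
    have h0 : 0 ≤ (ys.map fun p => ‖p.2‖).prod := List.prod_nonneg fun r hr => by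
      obtain ⟨p, _, rfl⟩ := List.mem_map.1 hr
      exact norm_nonneg _
    rw [wordMul]
    split
    · simp only [List.map_cons, List.prod_cons, List.map_nil, List.prod_nil, mul_one]
      rw [← mul_assoc]
      exact mul_le_mul_of_nonneg_right (norm_mul_le _ _) h0
    · simp
  | x :: x' :: xs, v => by
    rw [wordMul, List.map_cons, List.prod_cons, List.map_cons (l := x' :: xs), List.prod_cons,
      mul_assoc]
    exact mul_le_mul_of_nonneg_left (wordMul_norm_le (x' :: xs) v) (norm_nonneg _)

/-- The involution on words. -/
def wordStar (u : List (ℕ × A)) : List (ℕ × A) := (u.map fun p => (p.1, star p.2)).reverse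

theorem wordStar_wordStar (u : List (ℕ × A)) : wordStar (wordStar u) = u := by
  simp [wordStar, Function.comp_def]

theorem wordStar_wordMul (u v : List (ℕ × A)) (hu : u ≠ []) (hv : v ≠ []) :
    wordStar (wordMul u v) = wordMul (wordStar v) (wordStar u) := by
  have hu' : wordStar u ≠ [] := by simpa [wordStar] using hu
  have hv' : wordStar v ≠ [] := by simpa [wordStar] using hv
  rw [wordMul_eq u v hu hv, wordMul_eq _ _ hv' hu']
  have e1 : (wordStar v).getLast hv' = ((v.head hv).1, star (v.head hv).2) := by
    simp [wordStar]
  have e2 : (wordStar u).head hu' = ((u.getLast hu).1, star (u.getLast hu).2) := by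
    simp [wordStar]
  rw [e1, e2]
  by_cases h : (u.getLast hu).1 = (v.head hv).1
  · rw [if_pos h, if_pos h.symm, h]
    simp [wordStar]
  · rw [if_neg h, if_neg (Ne.symm h)]
    simp [wordStar]

theorem word_ne_nil (a : Fin μ.length → A) : word μ a ≠ [] := by
  have := μ.length_pos
  rw [← List.length_pos_iff]
  simpa [word] using this

theorem word_prod (a : Fin μ.length → A) :
    ((word μ a).map fun p => ‖p.2‖).prod = ∏ i, ‖a i‖ := by
  simp [word, List.map_ofFn, List.prod_ofFn]

theorem word_mulTuple (a : Fin μ.length → A) (b : Fin ν.length → A) :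
    word (μ * ν) (mulTuple μ ν a b) = wordMul (word μ a) (word ν b) := by
  have hμ := μ.length_pos
  have hν := ν.length_pos
  have e1 : (word μ a).getLast (word_ne_nil μ a) =
      (μ.last, a ⟨μ.length - 1, by omega⟩) := by
    rw [List.getLast_eq_getElem]
    simp [word, AltSeq.last, List.getLast_eq_getElem, AltSeq.length]
    rfl
  have e2 : (word ν b).head (word_ne_nil ν b) = (ν.first, b ⟨0, hν⟩) := by
    rw [List.head_eq_getElem]
    simp [word, AltSeq.first, List.head_eq_getElem]
    rfl
  rw [wordMul_eq _ _ (word_ne_nil μ a) (word_ne_nil ν b), e1, e2]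
  by_cases h : μ.last = ν.first
  · have hl := AltSeq.length_mul_of_eq h
    rw [if_pos h]
    refine List.ext_getElem ?_ fun i h1 h2 => ?_
    · simp only [List.length_append, List.length_cons, List.length_dropLast, List.length_tail, word,
        List.length_ofFn]
      omega
    · have hlast : μ.val[μ.length - 1]'(Nat.sub_lt hμ one_pos) = μ.last := by
        simp only [AltSeq.last, List.getLast_eq_getElem]
        rfl
      have hv : (μ * ν).val = μ.val ++ ν.val.tail := by rw [AltSeq.val_mul, if_pos h]
      simp only [word, List.length_ofFn] at h1 h2 ⊢
      simp only [List.getElem_ofFn, mulTuple, h, hv, List.getElem_append, List.getElem_cons,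
        List.getElem_dropLast, List.getElem_tail, List.length_dropLast, List.length_ofFn]
      have hlen : μ.val.length = μ.length := rfl
      grind
  · have hl := AltSeq.length_mul_of_ne h
    rw [if_neg h]
    refine List.ext_getElem ?_ fun i h1 h2 => ?_
    · simp [word]; omega
    · have hv : (μ * ν).val = μ.val ++ ν.val := by rw [AltSeq.val_mul, if_neg h]
      simp only [word, List.length_ofFn] at h1 h2 ⊢
      simp only [List.getElem_ofFn, List.getElem_append, mulTuple, h, hv, List.length_ofFn]
      have hlen : μ.val.length = μ.length := rfl
      grind

theorem norm_mulTuple_le (a : Fin μ.length → A) (b : Fin ν.length → A) :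
    ∏ i, ‖mulTuple μ ν a b i‖ ≤ (∏ i, ‖a i‖) * ∏ i, ‖b i‖ := by
  rw [← word_prod, ← word_prod, ← word_prod, word_mulTuple]
  exact wordMul_norm_le _ _

/-- The product of elementary tensors, as a multilinear map of both tuples. -/
def mulMultilinear : MultilinearMap ℂ (fun _ : Fin μ.length => A)
    (MultilinearMap ℂ (fun _ : Fin ν.length => A) (ProjPower A (μ * ν).length)) where
  toFun a :=
    { toFun := fun b => ProjPower.tensor (mulTuple μ ν a b)
      map_update_add' := fun b j x y => by
        simp only [mulTuple_update_right, ProjPower.tensor, ← map_add]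
        rw [← MultilinearMap.map_update_add]
        congr 4
        split_ifs
        · exact mul_add _ _ _
        · rfl
      map_update_smul' := fun b j c x => by
        simp only [mulTuple_update_right, ProjPower.tensor, ← map_smul]
        rw [← MultilinearMap.map_update_smul]
        congr 4
        split_ifs
        · exact mul_smul_comm _ _ _
        · rfl }
  map_update_add' := fun a j x y => by
    ext b
    simp only [MultilinearMap.coe_mk, add_apply, mulTuple_update_left,
      ProjPower.tensor, ← map_add]
    rw [← MultilinearMap.map_update_add]
    congr 4
    split_ifs
    · exact add_mul _ _ _
    · rfl
  map_update_smul' := fun a j c x => by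
    ext b
    simp only [MultilinearMap.coe_mk, smul_apply, mulTuple_update_left,
      ProjPower.tensor, ← map_smul]
    rw [← MultilinearMap.map_update_smul]
    congr 4
    split_ifs
    · exact smul_mul_assoc _ _ _
    · rfl

theorem norm_mulMultilinear_le (a : Fin μ.length → A) (b : Fin ν.length → A) :
    ‖mulMultilinear μ ν a b‖ ≤ 1 * (∏ i, ‖a i‖) * ∏ i, ‖b i‖ := by
  rw [one_mul]
  exact (ProjPower.norm_tensor_le _).trans (norm_mulTuple_le μ ν a b)

/-- The product `Σ_μ × Σ_ν → Σ_{μ·ν}` of the family of Banach spaces `Σ`. -/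
def fiberMul : ProjPower A μ.length →L[ℂ] ProjPower A ν.length →L[ℂ] ProjPower A (μ * ν).length :=
  ProjPower.lift (ProjPower.lift.compContinuousMultilinearMap
    ((mulMultilinear μ ν).mkContinuousMultilinear 1 (norm_mulMultilinear_le μ ν)))

theorem fiberMul_tensor (a : Fin μ.length → A) (b : Fin ν.length → A) :
    fiberMul μ ν (ProjPower.tensor a) (ProjPower.tensor b) =
      ProjPower.tensor (mulTuple μ ν a b) := by
  rw [fiberMul, ProjPower.lift_tensor]
  exact ProjPower.lift_tensor _ b

theorem norm_fiberMul_le (x : ProjPower A μ.length) (y : ProjPower A ν.length) :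
    ‖fiberMul μ ν x y‖ ≤ ‖x‖ * ‖y‖ := by
  let M := (mulMultilinear μ ν (A := A)).mkContinuousMultilinear 1 (norm_mulMultilinear_le μ ν)
  have hM : ‖M‖ ≤ 1 :=
    MultilinearMap.mkContinuousMultilinear_norm_le _ zero_le_one (norm_mulMultilinear_le μ ν)
  have h1 : ‖ProjPower.lift.compContinuousMultilinearMap M‖ ≤ 1 := by
    refine ContinuousMultilinearMap.opNorm_le_bound zero_le_one fun m => ?_
    refine (ProjPower.norm_lift_le (M m)).trans ((M.le_opNorm m).trans ?_)
    gcongr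
  refine ((fiberMul μ ν x).le_opNorm y).trans ?_
  gcongr
  refine (ProjPower.norm_lift_apply_le _ x).trans ?_
  calc _ ≤ 1 * ‖x‖ := by gcongr
    _ = _ := one_mul _

/-! ### Fibrewise involution -/

/-- The tuple `(aₙ⋆, …, a₁⋆)`, with `m = n` its length. -/
def starTuple {n m : ℕ} (h : n = m) (a : Fin n → A) : Fin m → A :=
  fun i => star (a (Fin.rev (Fin.cast h.symm i)))

theorem starTuple_update {n m : ℕ} (h : n = m) [DecidableEq (Fin n)] (a : Fin n → A) (j : Fin n)
    (x : A) : starTuple h (Function.update a j x) =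
      Function.update (starTuple h a) (Fin.cast h (Fin.rev j)) (star x) := by
  subst h
  funext i
  have : Fin.rev i = j ↔ i = Fin.rev j := Fin.rev_eq_iff
  simp [starTuple, Function.update_apply, this, apply_ite star]

theorem word_starTuple (a : Fin μ.length → A) :
    word (star μ) (starTuple (AltSeq.length_star μ).symm a) = wordStar (word μ a) := by
  have hlen : μ.val.length = μ.length := rfl
  refine List.ext_getElem ?_ fun i h1 h2 => ?_
  · simp [word, wordStar, AltSeq.length_star]
  · simp only [word, wordStar, List.getElem_ofFn, List.getElem_reverse, List.getElem_map,
      List.length_map, List.length_ofFn, starTuple, AltSeq.val_star, Prod.mk.injEq] at h1 h2 ⊢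
    refine ⟨by simp only [hlen]; rfl, ?_⟩
    congr 2
    ext
    simp [Fin.val_rev]
    omega

theorem prod_starTuple {n m : ℕ} (h : n = m) (a : Fin n → A) :
    ∏ i, ‖starTuple h a i‖ = ∏ i, ‖a i‖ := by
  subst h
  simp only [starTuple, norm_star, Fin.cast_eq_self]
  exact Equiv.prod_comp Fin.revPerm fun i => ‖a i‖

/-- The involution on the algebraic tensor powers, `c • a₁ ⊗ ⋯ ⊗ aₙ ↦ c̄ • aₙ⋆ ⊗ ⋯ ⊗ a₁⋆`. -/
def algStarAdd {n m : ℕ} (h : n = m) : (⨂[ℂ] _ : Fin n, A) →+ ⨂[ℂ] _ : Fin m, A :=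
  PiTensorProduct.liftAddHom
    (fun p => (starRingEnd ℂ) p.1 • PiTensorProduct.tprod ℂ (starTuple h p.2))
    (fun r f i hi => by
      have : starTuple h f (Fin.cast h (Fin.rev i)) = 0 := by
        subst h; simp [starTuple, hi]
      rw [MultilinearMap.map_coord_zero _ _ this, smul_zero])
    (fun f => by simp)
    (fun r f i x y => by
      simp only [starTuple_update, star_add, MultilinearMap.map_update_add, smul_add])
    (fun r r' f => by simp [add_smul])
    (fun r f i c => by
      simp only [starTuple_update, star_smul, MultilinearMap.map_update_smul]
      have : Function.update (starTuple h f) (Fin.cast h (Fin.rev i)) (star (f i)) =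
          starTuple h f := by
        rw [← starTuple_update, Function.update_eq_self]
      rw [this, smul_smul, map_mul, mul_comm]
      rfl)

theorem algStarAdd_tprod {n m : ℕ} (h : n = m) (c : ℂ) (a : Fin n → A) :
    algStarAdd h (c • PiTensorProduct.tprod ℂ a) =
      (starRingEnd ℂ) c • PiTensorProduct.tprod ℂ (starTuple h a) := by
  rw [← PiTensorProduct.tprodCoeff_eq_smul_tprod]
  rfl

/-- The involution on the algebraic tensor powers, as an antilinear map. -/
def algStar {n m : ℕ} (h : n = m) : (⨂[ℂ] _ : Fin n, A) →ₗ⋆[ℂ] ⨂[ℂ] _ : Fin m, A where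
  toFun := algStarAdd h
  map_add' := map_add _
  map_smul' c x := by
    induction x using PiTensorProduct.induction_on with
    | smul_tprod r f => simp only [smul_smul, algStarAdd_tprod, map_mul]
    | add x y hx hy => rw [smul_add, map_add, hx, hy, map_add, smul_add]

theorem norm_algStar_list_le {n m : ℕ} (h : n = m) : ∀ l : List (ℂ × (Fin n → A)),
    ‖algStar (A := A) h (l.map fun p => p.1 • PiTensorProduct.tprod ℂ p.2).sum‖ ≤
      (l.map fun p => ‖p.1‖ * ∏ i, ‖p.2 i‖).sum
  | [] => by simp
  | p :: l => by
    simp only [List.map_cons, List.sum_cons, map_add]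
    refine (norm_add_le _ _).trans (add_le_add ?_ (norm_algStar_list_le h l))
    have : algStar h (p.1 • PiTensorProduct.tprod ℂ p.2) =
      (starRingEnd ℂ) p.1 • PiTensorProduct.tprod ℂ (starTuple h p.2) := algStarAdd_tprod h p.1 p.2
    rw [this, norm_smul, RCLike.norm_conj, ← prod_starTuple h]
    gcongr
    exact PiTensorProduct.projectiveSeminorm_tprod_le _

theorem norm_algStar_le {n m : ℕ} (h : n = m) (x : ⨂[ℂ] _ : Fin n, A) :
    ‖algStar h x‖ ≤ ‖x‖ := by
  rw [PiTensorProduct.norm_def x]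
  refine le_ciInf fun ⟨p, hp⟩ => ?_
  rw [PiTensorProduct.mem_lifts_iff] at hp
  have := norm_algStar_list_le h p.toList
  rw [hp] at this
  exact this

/-- The antilinear isometry `Σ_n → Σ_m`, `m = n`, with `a₁ ⊗ ⋯ ⊗ aₙ ↦ aₙ⋆ ⊗ ⋯ ⊗ a₁⋆`. -/
def fiberStar {n m : ℕ} (h : n = m) : ProjPower A n →L⋆[ℂ] ProjPower A m :=
  ((ProjPower.mk A m).toLinearMap.comp (algStar h)).extendOfNorm (ProjPower.mk A n).toLinearMap

theorem norm_algStar_le_mk {n m : ℕ} (h : n = m) (x : ⨂[ℂ] _ : Fin n, A) :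
    ‖((ProjPower.mk A m).toLinearMap.comp (algStar h)) x‖ ≤ 1 * ‖(ProjPower.mk A n).toLinearMap x‖ := by
  rw [one_mul]
  exact (((ProjPower.mk A m).norm_map _).trans_le (norm_algStar_le h x)).trans_eq
    ((ProjPower.mk A n).norm_map x).symm

theorem fiberStar_tensor {n m : ℕ} (h : n = m) (a : Fin n → A) :
    fiberStar h (ProjPower.tensor a) = ProjPower.tensor (starTuple h a) := by
  have := LinearMap.extendOfNorm_eq (f := (ProjPower.mk A m).toLinearMap.comp (algStar h))
    (e := (ProjPower.mk A n).toLinearMap) ProjPower.denseRange_mk ⟨_, norm_algStar_le_mk h⟩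
    (PiTensorProduct.tprod ℂ a)
  refine this.trans (congrArg (ProjPower.mk A m) ?_)
  have := algStarAdd_tprod h 1 a
  rwa [one_smul, map_one, one_smul] at this

theorem norm_fiberStar_le {n m : ℕ} (h : n = m) (x : ProjPower A n) : ‖fiberStar h x‖ ≤ ‖x‖ :=
  (LinearMap.norm_extendOfNorm_apply_le ProjPower.denseRange_mk _ (norm_algStar_le_mk h) x).trans_eq
    (one_mul _)

end Fibres

end

/-! ### The Banach `*`-algebra `ℓ¹(Σ)` -/

noncomputable section

/-- `ℓ¹(Σ)`: the summable sections `μ ↦ f μ ∈ Σ_μ`, with `‖f‖ = ∑ ‖f μ‖`. -/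
def L1Sigma (A : Type u) [NonUnitalCStarAlgebra A] : Type u :=
  lp (fun μ : AltSeq => ProjPower A μ.length) 1

namespace L1Sigma

variable {A : Type u} [NonUnitalCStarAlgebra A]

instance : NormedAddCommGroup (L1Sigma A) :=
  inferInstanceAs (NormedAddCommGroup (lp (fun μ : AltSeq => ProjPower A μ.length) 1))
instance : NormedSpace ℂ (L1Sigma A) :=
  inferInstanceAs (NormedSpace ℂ (lp (fun μ : AltSeq => ProjPower A μ.length) 1))
instance : CompleteSpace (L1Sigma A) :=
  inferInstanceAs (CompleteSpace (lp (fun μ : AltSeq => ProjPower A μ.length) 1))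

instance : CoeFun (L1Sigma A) fun _ => ∀ μ : AltSeq, ProjPower A μ.length :=
  ⟨fun f => f.1⟩

theorem ext {f g : L1Sigma A} (h : ∀ μ, f μ = g μ) : f = g := Subtype.ext (funext h)

theorem add_apply (f g : L1Sigma A) (μ : AltSeq) : (f + g) μ = f μ + g μ := rfl

theorem smul_apply (c : ℂ) (f : L1Sigma A) (μ : AltSeq) : (c • f) μ = c • f μ := rfl

theorem hasSum_norm (f : L1Sigma A) : HasSum (fun μ => ‖f μ‖) ‖f‖ := by
  have := lp.hasSum_norm (p := 1) (by simp)
    (show lp (fun μ : AltSeq => ProjPower A μ.length) 1 from f)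
  simp only [ENNReal.toReal_one, Real.rpow_one] at this
  exact this

theorem norm_eq_tsum (f : L1Sigma A) : ‖f‖ = ∑' μ, ‖f μ‖ := (hasSum_norm f).tsum_eq.symm

theorem norm_apply_le (f : L1Sigma A) (μ : AltSeq) : ‖f μ‖ ≤ ‖f‖ :=
  le_hasSum (hasSum_norm f) μ fun _ _ => norm_nonneg _

/-- Evaluation at `μ`. -/
def eval (μ : AltSeq) : L1Sigma A →L[ℂ] ProjPower A μ.length :=
  LinearMap.mkContinuous
    { toFun := fun f => f μ
      map_add' := fun _ _ => rfl
      map_smul' := fun _ _ => rfl } 1 fun f => by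
    rw [one_mul]; exact norm_apply_le f μ

theorem eval_apply (μ : AltSeq) (f : L1Sigma A) : eval μ f = f μ := rfl

/-- `δ_μ · ξ`: the section with the value `ξ` at `μ` and zero elsewhere. -/
def delta (μ : AltSeq) (ξ : ProjPower A μ.length) : L1Sigma A :=
  lp.single (E := fun μ : AltSeq => ProjPower A μ.length) 1 μ ξ

theorem delta_apply (μ ν : AltSeq) (ξ : ProjPower A μ.length) :
    delta μ ξ ν = Pi.single (M := fun μ : AltSeq => ProjPower A μ.length) μ ξ ν := rfl

theorem delta_apply_self (μ : AltSeq) (ξ : ProjPower A μ.length) : delta μ ξ μ = ξ :=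
  lp.single_apply_self (E := fun μ : AltSeq => ProjPower A μ.length) 1 μ ξ

theorem delta_apply_ne {μ ν : AltSeq} (h : ν ≠ μ) (ξ : ProjPower A μ.length) :
    delta μ ξ ν = 0 :=
  lp.single_apply_ne (E := fun μ : AltSeq => ProjPower A μ.length) 1 μ ξ h

theorem norm_delta (μ : AltSeq) (ξ : ProjPower A μ.length) : ‖delta μ ξ‖ = ‖ξ‖ :=
  lp.norm_single (E := fun μ : AltSeq => ProjPower A μ.length) one_pos μ ξ

theorem delta_add (μ : AltSeq) (ξ η : ProjPower A μ.length) :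
    delta μ (ξ + η) = delta μ ξ + delta μ η :=
  lp.single_add (E := fun μ : AltSeq => ProjPower A μ.length) 1 μ ξ η

theorem delta_smul (μ : AltSeq) (c : ℂ) (ξ : ProjPower A μ.length) :
    delta μ (c • ξ) = c • delta μ ξ :=
  lp.single_smul (E := fun μ : AltSeq => ProjPower A μ.length) 1 μ c ξ

theorem delta_zero (μ : AltSeq) : delta μ (0 : ProjPower A μ.length) = 0 :=
  lp.single_zero (E := fun μ : AltSeq => ProjPower A μ.length) 1 μ

theorem continuous_delta (μ : AltSeq) :
    Continuous (delta μ : ProjPower A μ.length → L1Sigma A) :=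
  AddMonoidHomClass.continuous_of_bound
    (AddMonoidHom.mk' (delta μ : ProjPower A μ.length → L1Sigma A) (delta_add μ)) 1
    fun x => by rw [one_mul]; exact (norm_delta μ x).le

theorem hasSum_delta (f : L1Sigma A) : HasSum (fun μ => delta μ (f μ)) f :=
  lp.hasSum_single (E := fun μ : AltSeq => ProjPower A μ.length) ENNReal.one_ne_top f

/-- The elementary function `δ_μ · a₁ ⊗ ⋯ ⊗ aₖ`. -/
def elem (μ : AltSeq) (a : Fin μ.length → A) : L1Sigma A := delta μ (ProjPower.tensor a)

/-- The elementary functions have `ℓ¹(Σ)` as their closed linear span. -/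
theorem induction_on {p : L1Sigma A → Prop} (hc : IsClosed {f | p f})
    (hs : ∀ (c : ℂ) (μ : AltSeq) (a : Fin μ.length → A), p (c • elem μ a))
    (ha : ∀ f g, p f → p g → p (f + g)) (f : L1Sigma A) : p f := by
  have h1 : ∀ μ (ξ : ProjPower A μ.length), p (delta μ ξ) := fun μ ξ => by
    refine ProjPower.induction_on (p := fun ξ => p (delta μ ξ))
      (hc.preimage (continuous_delta μ)) (fun c a => ?_) (fun x y hx hy => ?_) ξ
    · rw [delta_smul]; exact hs c μ a
    · rw [delta_add]; exact ha _ _ hx hy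
  have h0 : p 0 := by
    have := h1 (AltSeq.single 0) 0
    rwa [delta_zero] at this
  refine hc.mem_of_tendsto (hasSum_delta f) (Filter.Eventually.of_forall fun s => ?_)
  change p (∑ μ ∈ s, delta μ (f μ))
  induction s using Finset.induction_on with
  | empty => simpa using h0
  | insert μ s hμ ih =>
    rw [Finset.sum_insert hμ]
    exact ha _ _ (h1 μ _) ih

/-- Elementary functions with the same words are equal. -/
theorem elem_congr {μ ν : AltSeq} {a : Fin μ.length → A} {b : Fin ν.length → A}
    (h : word μ a = word ν b) : elem μ a = elem ν b := by
  have hlen : μ.length = ν.length := by simpa [word] using congrArg List.length h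
  have hμν : μ = ν := by
    refine AltSeq.ext (List.ext_getElem hlen fun i h1 h2 => ?_)
    have := List.getElem_of_eq h (i := i) (by rw [word, List.length_ofFn]; exact h1)
    simp only [word, List.getElem_ofFn] at this
    exact congrArg Prod.fst this
  subst hμν
  congr 1
  funext i
  have := List.getElem_of_eq h (i := i.1) (by simp [word])
  simpa [word] using congrArg Prod.snd this

/-! #### Convolution -/

/-- The `(λ, μ)` term `δ_{λ·μ} · (f(λ) · g(μ))` of the convolution. -/
def mulTerm (f g : L1Sigma A) (p : AltSeq × AltSeq) : L1Sigma A :=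
  delta (p.1 * p.2) (fiberMul p.1 p.2 (f p.1) (g p.2))

theorem norm_mulTerm_le (f g : L1Sigma A) (p : AltSeq × AltSeq) :
    ‖mulTerm f g p‖ ≤ ‖f p.1‖ * ‖g p.2‖ :=
  (norm_delta _ _).trans_le (norm_fiberMul_le p.1 p.2 _ _)

theorem summable_norms (f g : L1Sigma A) :
    Summable fun p : AltSeq × AltSeq => ‖f p.1‖ * ‖g p.2‖ :=
  (hasSum_norm f).summable.mul_of_nonneg (hasSum_norm g).summable
    (fun _ => norm_nonneg _) (fun _ => norm_nonneg _)

theorem summable_mulTerm (f g : L1Sigma A) : Summable (mulTerm f g) :=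
  .of_norm_bounded (summable_norms f g) (norm_mulTerm_le f g)

/-- Convolution, `f * g = ∑_{λ,μ} δ_{λ·μ} · (f(λ) · g(μ))`. See also `mul_apply`. -/
instance : Mul (L1Sigma A) := ⟨fun f g => ∑' p : AltSeq × AltSeq, mulTerm f g p⟩

theorem mul_def (f g : L1Sigma A) : f * g = ∑' p : AltSeq × AltSeq, mulTerm f g p := rfl

/-- `(f * g)(ν) = ∑_{λ·μ = ν} f(λ) · g(μ)`. -/
theorem mul_apply (f g : L1Sigma A) (ν : AltSeq) :
    (f * g) ν = ∑' p : {p : AltSeq × AltSeq // p.1 * p.2 = ν},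
      p.2 ▸ fiberMul p.1.1 p.1.2 (f p.1.1) (g p.1.2) := by
  have h1 : (f * g) ν = ∑' p : AltSeq × AltSeq, mulTerm f g p ν := by
    rw [mul_def, ← eval_apply, (eval ν).map_tsum (summable_mulTerm f g)]
    rfl
  rw [h1, ← tsum_subtype_eq_of_support_subset (s := {p : AltSeq × AltSeq | p.1 * p.2 = ν})]
  · refine tsum_congr fun p => ?_
    obtain ⟨⟨l, m⟩, h⟩ := p
    change l * m = ν at h
    subst h
    exact delta_apply_self _ _
  · intro p hp
    by_contra h
    exact hp (delta_apply_ne (fun e => h e.symm) _)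

theorem norm_mul_le' (f g : L1Sigma A) : ‖f * g‖ ≤ ‖f‖ * ‖g‖ := by
  rw [mul_def, norm_eq_tsum f, norm_eq_tsum g,
    (hasSum_norm f).summable.tsum_mul_tsum (hasSum_norm g).summable (summable_norms f g)]
  exact tsum_of_norm_bounded (summable_norms f g).hasSum (norm_mulTerm_le f g)

theorem add_mul' (f g h : L1Sigma A) : (f + g) * h = f * h + g * h := by
  rw [mul_def, mul_def, mul_def, ← (summable_mulTerm f h).tsum_add (summable_mulTerm g h)]
  refine tsum_congr fun p => ?_
  simp only [mulTerm, add_apply, map_add, _root_.add_apply, delta_add]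

theorem mul_add' (f g h : L1Sigma A) : f * (g + h) = f * g + f * h := by
  rw [mul_def, mul_def, mul_def, ← (summable_mulTerm f g).tsum_add (summable_mulTerm f h)]
  refine tsum_congr fun p => ?_
  simp only [mulTerm, add_apply, map_add, delta_add]

theorem smul_mul' (c : ℂ) (f g : L1Sigma A) : (c • f) * g = c • (f * g) := by
  rw [mul_def, mul_def, ← (summable_mulTerm f g).tsum_const_smul]
  refine tsum_congr fun p => ?_
  simp only [mulTerm, smul_apply, map_smul, _root_.smul_apply, delta_smul]

theorem mul_smul' (c : ℂ) (f g : L1Sigma A) : f * (c • g) = c • (f * g) := by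
  rw [mul_def, mul_def, ← (summable_mulTerm f g).tsum_const_smul]
  refine tsum_congr fun p => ?_
  simp only [mulTerm, smul_apply, map_smul, delta_smul]

theorem continuous_mul_left (f : L1Sigma A) : Continuous fun g => f * g :=
  AddMonoidHomClass.continuous_of_bound (AddMonoidHom.mk' (fun g => f * g) (mul_add' f)) ‖f‖
    (norm_mul_le' f)

theorem continuous_mul_right (g : L1Sigma A) : Continuous fun f => f * g :=
  AddMonoidHomClass.continuous_of_bound
    (AddMonoidHom.mk' (fun f => f * g) fun f h => add_mul' f h g) ‖g‖
    fun f => (norm_mul_le' f g).trans_eq (mul_comm _ _)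

theorem zero_mul' (f : L1Sigma A) : 0 * f = 0 := by
  have := add_mul' 0 0 f
  rw [add_zero] at this
  exact left_eq_add.1 this

theorem mul_zero' (f : L1Sigma A) : f * 0 = 0 := by
  have := mul_add' f 0 0
  rw [add_zero] at this
  exact left_eq_add.1 this

theorem delta_mul_delta (μ ν : AltSeq) (ξ : ProjPower A μ.length) (η : ProjPower A ν.length) :
    delta μ ξ * delta ν η = delta (μ * ν) (fiberMul μ ν ξ η) := by
  rw [mul_def, tsum_eq_single (μ, ν)]
  · simp only [mulTerm, delta_apply_self]
  · rintro ⟨l, m⟩ h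
    by_cases h1 : l = μ
    · have h2 : m ≠ ν := fun h2 => h (by rw [h1, h2])
      simp only [mulTerm, delta_apply_ne h2, map_zero, delta_zero]
    · simp only [mulTerm, delta_apply_ne h1, map_zero, _root_.zero_apply, delta_zero]

theorem elem_mul_elem (μ ν : AltSeq) (a : Fin μ.length → A) (b : Fin ν.length → A) :
    elem μ a * elem ν b = elem (μ * ν) (mulTuple μ ν a b) := by
  rw [elem, elem, delta_mul_delta, fiberMul_tensor, elem]

theorem mul_assoc' (f g h : L1Sigma A) : f * g * h = f * (g * h) := by
  refine induction_on (p := fun f => f * g * h = f * (g * h))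
    (isClosed_eq ((continuous_mul_right h).comp (continuous_mul_right g))
      (continuous_mul_right _)) (fun c μ a => ?_) (fun f f' h1 h2 => ?_) f
  swap
  · rw [add_mul', add_mul', add_mul', h1, h2]
  rw [smul_mul', smul_mul', smul_mul']
  congr 1
  refine induction_on (p := fun g => elem μ a * g * h = elem μ a * (g * h))
    (isClosed_eq ((continuous_mul_right h).comp (continuous_mul_left _))
      ((continuous_mul_left _).comp (continuous_mul_right h)))
    (fun c ν b => ?_) (fun f f' h1 h2 => ?_) g
  swap
  · rw [mul_add', add_mul', add_mul', mul_add', h1, h2]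
  rw [mul_smul', smul_mul', smul_mul', mul_smul']
  congr 1
  refine induction_on (p := fun h => elem μ a * elem ν b * h = elem μ a * (elem ν b * h))
    (isClosed_eq (continuous_mul_left _) ((continuous_mul_left _).comp (continuous_mul_left _)))
    (fun c κ d => ?_) (fun f f' h1 h2 => ?_) h
  swap
  · rw [mul_add', mul_add', mul_add', h1, h2]
  rw [mul_smul', mul_smul', mul_smul']
  congr 1
  rw [elem_mul_elem, elem_mul_elem, elem_mul_elem, elem_mul_elem]
  refine elem_congr ?_
  rw [word_mulTuple, word_mulTuple, word_mulTuple, word_mulTuple,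
    wordMul_assoc _ _ _ (word_ne_nil ν b)]

instance : NonUnitalNormedRing (L1Sigma A) :=
  { (inferInstance : NormedAddCommGroup (L1Sigma A)),
    (inferInstance : Mul (L1Sigma A)) with
    zero_mul := zero_mul'
    mul_zero := mul_zero'
    mul_assoc := mul_assoc'
    left_distrib := mul_add'
    right_distrib := add_mul'
    norm_mul_le := norm_mul_le' }

/-! #### Involution -/

/-- The involution `f⋆(μ) = f(μ⋆)⋆`. -/
instance : Star (L1Sigma A) where
  star f := ⟨fun μ => fiberStar (AltSeq.length_star μ) (f (star μ)), by
    refine memℓp_gen ?_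
    have h : Summable fun μ : AltSeq => ‖f (star μ)‖ :=
      (hasSum_norm f).summable.comp_injective star_injective
    simpa using Summable.of_nonneg_of_le (fun _ => norm_nonneg _)
      (fun μ => norm_fiberStar_le (AltSeq.length_star μ) (f (star μ))) h⟩

theorem star_apply (f : L1Sigma A) (μ : AltSeq) :
    (star f) μ = fiberStar (AltSeq.length_star μ) (f (star μ)) := rfl

theorem norm_star_le' (f : L1Sigma A) : ‖star f‖ ≤ ‖f‖ := by
  have h := (Equiv.hasSum_iff (f := fun μ => ‖f μ‖)
    (star_involutive (R := AltSeq)).toPerm).2 (hasSum_norm f)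
  exact hasSum_le (fun μ => norm_fiberStar_le (AltSeq.length_star μ) (f (star μ)))
    (hasSum_norm (star f)) h

theorem star_add' (f g : L1Sigma A) : star (f + g) = star f + star g :=
  ext fun μ => by simp only [star_apply, add_apply, map_add]

theorem star_smul' (c : ℂ) (f : L1Sigma A) : star (c • f) = star c • star f :=
  ext fun μ => by
    simp only [star_apply, smul_apply, map_smulₛₗ]
    rfl

theorem continuous_star' : Continuous (star : L1Sigma A → L1Sigma A) :=
  AddMonoidHomClass.continuous_of_bound (AddMonoidHom.mk' star star_add') 1
    fun f => by rw [one_mul]; exact norm_star_le' f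

theorem star_delta (μ : AltSeq) (ξ : ProjPower A μ.length) :
    star (delta μ ξ) = delta (star μ) (fiberStar (AltSeq.length_star μ).symm ξ) := by
  refine ext fun ν => ?_
  rw [star_apply]
  by_cases h : ν = star μ
  · subst h
    rw [delta_apply_self]
    have key : ∀ (κ : AltSeq) (e : κ = μ) (h1 : κ.length = (star μ).length),
        fiberStar h1 (delta μ ξ κ) = fiberStar (AltSeq.length_star μ).symm ξ := by
      rintro κ rfl h1
      rw [delta_apply_self]
    exact key _ (star_star μ) _
  · have h' : star ν ≠ μ := fun e => h (by rw [← e, star_star])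
    rw [delta_apply_ne h', delta_apply_ne h, map_zero]

theorem star_elem (μ : AltSeq) (a : Fin μ.length → A) :
    star (elem μ a) = elem (star μ) (starTuple (AltSeq.length_star μ).symm a) := by
  rw [elem, star_delta, fiberStar_tensor, elem]

theorem star_star' (f : L1Sigma A) : star (star f) = f := by
  refine induction_on (p := fun f => star (star f) = f)
    (isClosed_eq (continuous_star'.comp continuous_star') continuous_id)
    (fun c μ a => ?_) (fun f g h1 h2 => ?_) f
  · rw [star_smul', star_smul', star_star, star_elem, star_elem]
    congr 1
    refine elem_congr ?_
    rw [word_starTuple, word_starTuple, wordStar_wordStar]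
  · rw [star_add', star_add', h1, h2]

theorem star_mul' (f g : L1Sigma A) : star (f * g) = star g * star f := by
  refine induction_on (p := fun f => star (f * g) = star g * star f)
    (isClosed_eq (continuous_star'.comp (continuous_mul_right g))
      ((continuous_mul_left _).comp continuous_star')) (fun c μ a => ?_) (fun f f' h1 h2 => ?_) f
  swap
  · rw [add_mul', star_add', star_add', mul_add', h1, h2]
  rw [smul_mul', star_smul', star_smul', mul_smul']
  congr 1
  refine induction_on (p := fun g => star (elem μ a * g) = star g * star (elem μ a))
    (isClosed_eq (continuous_star'.comp (continuous_mul_left _))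
      ((continuous_mul_right _).comp continuous_star')) (fun c ν b => ?_) (fun f f' h1 h2 => ?_) g
  swap
  · rw [mul_add', star_add', star_add', add_mul', h1, h2]
  rw [mul_smul', star_smul', star_smul', smul_mul']
  congr 1
  rw [elem_mul_elem, star_elem, star_elem, star_elem, elem_mul_elem]
  refine elem_congr ?_
  rw [word_starTuple, word_mulTuple, word_mulTuple, word_starTuple, word_starTuple,
    wordStar_wordMul _ _ (word_ne_nil μ a) (word_ne_nil ν b)]

instance : StarRing (L1Sigma A) where
  star_involutive := star_star'
  star_mul := star_mul'
  star_add := star_add'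

instance : BanachStarAlgebra (L1Sigma A) where
  smul_assoc := smul_mul'
  smul_comm c f g := (mul_smul' c f g).symm
  star_smul := star_smul'
  norm_star_le := norm_star_le'

theorem word_single (k : ℕ) (a : A) : word (AltSeq.single k) (fun _ => a) = [(k, a)] := rfl

theorem elem_single_eq (k : ℕ) (a : A) : elem (AltSeq.single k) (fun _ => a) =
    delta (AltSeq.single k) (ProjPower.mk A 1 (PiTensorProduct.tprod ℂ
      (Function.update (fun _ : Fin 1 => (0 : A)) 0 a))) := by
  have : Function.update (fun _ : Fin 1 => (0 : A)) 0 a = fun _ => a := by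
    funext i
    rw [Subsingleton.elim i 0, Function.update_self]
  rw [this]
  rfl

/-- The `*`-homomorphism `θ_k : A → ℓ¹(Σ)`, `θ_k(a) = δ_(k) · a`. -/
def theta (k : ℕ) : A →⋆ₙₐ[ℂ] L1Sigma A where
  toFun a := elem (AltSeq.single k) fun _ => a
  map_smul' c a := by
    simp only [elem_single_eq, MultilinearMap.map_update_smul, map_smul]
    exact delta_smul (AltSeq.single k) c _
  map_zero' := by
    have h := MultilinearMap.map_update_zero (PiTensorProduct.tprod ℂ)
      (fun _ : Fin 1 => (0 : A)) 0
    rw [elem_single_eq, h, map_zero]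
    exact delta_zero (AltSeq.single k)
  map_add' a b := by
    simp only [elem_single_eq, MultilinearMap.map_update_add, map_add]
    exact delta_add (AltSeq.single k) _ _
  map_mul' a b := by
    rw [elem_mul_elem]
    refine elem_congr ?_
    rw [word_mulTuple, word_single, word_single, word_single, wordMul, if_pos rfl]
  map_star' a := by
    rw [star_elem]
    refine elem_congr ?_
    rw [word_starTuple, word_single, word_single]
    rfl

end L1Sigma

/-! ### Infinite free products -/

/-- `P`, with `θ₀, θ₁, … : A → P`, is the free product `A * A * ⋯` of a sequence of copies of the
C⋆-algebra `A`: it is generated by the ranges of the `θ_k`, and every sequence of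
`*`-homomorphisms of `A` into a C⋆-algebra `D` (in the universe `v`) factors uniquely through it. -/
structure IsInfiniteFreeProduct {A : Type u} [NonUnitalCStarAlgebra A] {P : Type w}
    [NonUnitalCStarAlgebra P] (θ : ℕ → A →⋆ₙₐ[ℂ] P) : Prop where
  generates : Dense (NonUnitalStarAlgebra.adjoin ℂ (⋃ k, Set.range (θ k)) : Set P)
  existsUnique_factor : ∀ (D : Type v) [NonUnitalCStarAlgebra D] (π : ℕ → A →⋆ₙₐ[ℂ] D),
    ∃! ρ : P →⋆ₙₐ[ℂ] D, ∀ k, ρ.comp (θ k) = π k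

/-- The `*`-homomorphism `A → C⋆(ℓ¹(Σ))` defined by `θ_k`. -/
def thetaTilde {A : Type u} [NonUnitalCStarAlgebra A] (k : ℕ) :
    A →⋆ₙₐ[ℂ] BanachStarAlgebra.CStarEnvelope (L1Sigma A) :=
  (BanachStarAlgebra.CStarEnvelope.of (L1Sigma A)).comp (L1Sigma.theta k)

end

/-! For ν = (n₁, …, nₖ) neighbouring indices differ, so nothing merges in the product
θ_{n₁}(a₁)⋯θ_{nₖ}(aₖ), and it equals δ_ν · a₁ ⊗ ⋯ ⊗ aₖ. These elementary functions span a dense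
subspace of ℓ¹(Σ), whose image is dense in the envelope. Hence the ranges of the θ̃_k generate
(`dense_adjoin_thetaTilde`), and a `*`-homomorphism out of the envelope is determined by its
composites with the θ̃_k.

For existence, suppose first that the target E is unital. Send δ_ν · a₁ ⊗ ⋯ ⊗ aₖ to
π_{n₁}(a₁)⋯π_{nₖ}(aₖ). Since `*`-homomorphisms of C⋆-algebras are contractive, this is a contraction
on each Σ_ν, and the sum over ν converges absolutely on ℓ¹(Σ). It is multiplicative because letters
merge only when they carry the same index, and the homomorphism of that index is multiplicative
(`wordEval_wordMul`).

Extending this map to the envelope needs the bound ‖σ x‖ ≤ `envNorm x` for a `*`-homomorphism σ from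
a Banach `*`-algebra B to E. The seminorm only sees Hilbert spaces in the universe of B, whereas E
may lie in any universe. So the GNS construction is carried out on B itself: a positive functional f
on E gives the semi-inner product f(σ(x)⋆σ(y)) on B, whose completion carries a representation of B.
With f chosen to norm a suitable positive element, this representation yields `norm_map_le_envNorm`.

A target D without a unit is replaced by its unitization. The scalar part of the resulting
homomorphism vanishes on the generators, hence everywhere, so the homomorphism takes its values in
D.

The isomorphism with any other free product is the usual comparison of two universal objects. -/

noncomputable section

/-! ### Positive functionals that norm a positive element -/

section States

open scoped ComplexOrder

variable {E : Type*} [CStarAlgebra E] [PartialOrder E] [StarOrderedRing E]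

/-- The nontrivial half of `‖1 + a‖ = 1 + ‖a‖` for `a ≥ 0` in a nontrivial unital C⋆-algebra. -/
theorem one_add_norm_le_norm_one_add [Nontrivial E] {a : E} (ha : 0 ≤ a) :
    1 + ‖a‖ ≤ ‖1 + a‖ := by
  have h1 : ‖a‖ ∈ spectrum ℝ a := CStarAlgebra.norm_mem_spectrum_of_nonneg ha
  have h2 : 1 + ‖a‖ ∈ spectrum ℝ (1 + a) := by
    have := spectrum.add_mem_add_iff (R := ℝ) (s := 1) |>.2 h1
    rwa [map_one, add_comm ‖a‖] at this
  have h3 := spectrum.norm_le_norm_of_mem h2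
  rwa [Real.norm_of_nonneg (by positivity)] at h3

/-- A contractive functional with value `1` at `1` is real on self-adjoint elements. -/
theorem im_apply_eq_zero_of_isSelfAdjoint {g : StrongDual ℂ E} (hg : ‖g‖ ≤ 1) (h1 : g 1 = 1)
    {a : E} (ha : IsSelfAdjoint a) : (g a).im = 0 := by
  -- For self-adjoint a, ‖a + it‖² = ‖a² + t²‖ ≤ ‖a‖² + t², while |g(a) + it|² contains (Im g(a) +
  -- t)². The t² cancels and leaves a bound linear in t, which is impossible for all real t unless
  -- Im g(a) = 0.
  have key : ∀ t : ℝ, 2 * t * (g a).im ≤ ‖a‖ ^ 2 := fun t => by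
    have e : star (a + (t * Complex.I) • (1 : E)) * (a + (t * Complex.I) • (1 : E)) =
        star a * a + ((t : ℂ) ^ 2) • (1 : E) := by
      rw [star_add, star_smul, star_one, ha.star_eq]
      simp only [Complex.star_def, map_mul, Complex.conj_ofReal, Complex.conj_I, add_mul, mul_add,
        smul_mul_assoc, mul_smul_comm, one_mul, mul_one, smul_add, smul_smul]
      have : (t * Complex.I) * (t * -Complex.I) = (t : ℂ) ^ 2 := by
        linear_combination (-(t : ℂ) ^ 2) * Complex.I_sq
      rw [this, mul_neg, neg_smul]
      abel
    have h2 : ‖a + (t * Complex.I) • (1 : E)‖ ^ 2 ≤ ‖a‖ ^ 2 + t ^ 2 := by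
      have h1' : ‖(1 : E)‖ ≤ 1 := by
        nontriviality E
        exact CStarRing.norm_one.le
      rw [sq, ← CStarRing.norm_star_mul_self, e]
      refine (norm_add_le _ _).trans (add_le_add (by rw [CStarRing.norm_star_mul_self, sq]) ?_)
      rw [norm_smul, norm_pow, Complex.norm_real, Real.norm_eq_abs, sq_abs]
      exact mul_le_of_le_one_right (sq_nonneg t) h1'
    have h3 : ‖g (a + (t * Complex.I) • (1 : E))‖ ^ 2 ≤ ‖a‖ ^ 2 + t ^ 2 := by
      refine le_trans ?_ h2
      gcongr
      exact (g.le_of_opNorm_le hg _).trans_eq (one_mul _)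
    rw [map_add, map_smul, h1, Complex.sq_norm, Complex.normSq_apply] at h3
    simp at h3
    nlinarith [mul_self_nonneg (g a).re, mul_self_nonneg (g a).im]
  by_contra hne
  -- This t makes the left side 2(‖a‖² + 1), which exceeds ‖a‖².
  have := key ((‖a‖ ^ 2 + 1) / (g a).im)
  have e : 2 * ((‖a‖ ^ 2 + 1) / (g a).im) * (g a).im = 2 * (‖a‖ ^ 2 + 1) := by
    field_simp
  rw [e] at this
  nlinarith [sq_nonneg ‖a‖]

/-- A contractive functional with value `1` at `1` is positive. -/
theorem apply_nonneg_of_nonneg {g : StrongDual ℂ E} (hg : ‖g‖ ≤ 1) (h1 : g 1 = 1)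
    {a : E} (ha : 0 ≤ a) : 0 ≤ g a := by
  have him := im_apply_eq_zero_of_isSelfAdjoint hg h1 (IsSelfAdjoint.of_nonneg ha)
  refine Complex.nonneg_iff.2 ⟨?_, him.symm⟩
  -- From 0 ≤ a ≤ ‖a‖·1 the element ‖a‖·1 − a has norm at most ‖a‖. Applying g gives ‖a‖ − Re g(a) ≤
  -- ‖a‖, that is, Re g(a) ≥ 0.
  have hle : a ≤ algebraMap ℝ E ‖a‖ := IsSelfAdjoint.le_algebraMap_norm_self (.of_nonneg ha)
  have hn : ‖algebraMap ℝ E ‖a‖ - a‖ ≤ ‖a‖ := by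
    rw [CStarAlgebra.norm_le_iff_le_algebraMap _ (norm_nonneg a) (sub_nonneg.2 hle)]
    exact sub_le_self _ ha
  have h2 : ‖g (algebraMap ℝ E ‖a‖ - a)‖ ≤ ‖a‖ :=
    (g.le_of_opNorm_le hg _).trans (by rwa [one_mul])
  have e : g (algebraMap ℝ E ‖a‖) = ‖a‖ := by
    rw [Algebra.algebraMap_eq_smul_one, ← Complex.coe_smul, map_smul, h1, smul_eq_mul, mul_one]
  rw [map_sub, e] at h2
  have h3 := (Complex.re_le_norm _).trans h2
  rw [Complex.sub_re, Complex.ofReal_re] at h3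
  linarith

/-- Positive elements of a unital C⋆-algebra are normed by contractive positive functionals. -/
theorem exists_positive_apply_eq_norm {a : E} (ha : 0 ≤ a) :
    ∃ f : E →ₚ[ℂ] ℂ, f a = ‖a‖ ∧ ∀ b, ‖f b‖ ≤ ‖b‖ := by
  cases subsingleton_or_nontrivial E
  · exact ⟨0, by simp [Subsingleton.elim a 0], fun b => by simp⟩
  -- Norming 1 + a instead of a controls g at the unit as well: Re g(1) ≤ 1 and Re g(a) ≤ ‖a‖ add up
  -- to at least 1 + ‖a‖, so both are equalities. Then g(1) = 1 makes g positive.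
  obtain ⟨g, hg, hga⟩ := exists_dual_vector'' ℂ (1 + a)
  have hb : ∀ b, ‖g b‖ ≤ ‖b‖ := fun b => (g.le_of_opNorm_le hg b).trans_eq (one_mul _)
  have hre : (g 1).re + (g a).re = ‖1 + a‖ := by
    rw [← Complex.add_re, ← map_add, hga]
    rfl
  have hn := one_add_norm_le_norm_one_add ha
  have r1 : ‖g 1‖ ≤ 1 := (hb 1).trans_eq CStarRing.norm_one
  -- The disc of radius r meets the half-plane Re z ≥ r in at most the point r, so equality of real
  -- parts gives equality of complex numbers.
  have eq_of : ∀ (z : ℂ) (r : ℝ), ‖z‖ ≤ r → r ≤ z.re → z = r := fun z r h h' => by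
    have h2 : z.re = ‖z‖ := le_antisymm (Complex.re_le_norm z) (h.trans h')
    have h3 : z.re = r := le_antisymm ((Complex.re_le_norm z).trans h) h'
    rw [Complex.re_eq_norm] at h2
    exact Complex.ext h3 (by simpa using (Complex.nonneg_iff.1 h2).2.symm)
  have e1 : g 1 = (1 : ℝ) := eq_of _ _ r1 (by
    have := (Complex.re_le_norm _).trans (hb a)
    linarith)
  have ea : g a = ‖a‖ := eq_of _ _ (hb a) (by
    have := (Complex.re_le_norm _).trans r1
    linarith)
  rw [Complex.ofReal_one] at e1
  refine ⟨{ toLinearMap := g.toLinearMap, monotone' := fun x y hxy => ?_ }, ea, hb⟩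
  have := apply_nonneg_of_nonneg hg e1 (sub_nonneg.2 hxy)
  rw [map_sub] at this
  exact sub_nonneg.1 this

end States

namespace BanachStarAlgebra

/-! ### The GNS representation pulled back to a Banach `*`-algebra -/

section GNS

open UniformSpace UniformSpace.Completion
open scoped ComplexOrder InnerProductSpace

variable {B : Type u} [BanachStarAlgebra B] {E : Type v} [CStarAlgebra E] [PartialOrder E]
  [StarOrderedRing E]

/-- A copy of `B`, to carry the semi-inner product `(x, y) ↦ f (σ (x⋆ y))`. -/
@[nolint unusedArguments]
def PullbackGNS (_σ : B →⋆ₙₐ[ℂ] E) (_f : E →ₚ[ℂ] ℂ) : Type u := B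

namespace PullbackGNS

variable (σ : B →⋆ₙₐ[ℂ] E) (f : E →ₚ[ℂ] ℂ)

instance : AddCommGroup (PullbackGNS σ f) := inferInstanceAs (AddCommGroup B)
instance : Module ℂ (PullbackGNS σ f) := inferInstanceAs (Module ℂ B)

/-- The identity map of `B`, into the copy. -/
def of : B ≃ₗ[ℂ] PullbackGNS σ f := LinearEquiv.refl ℂ B

/-- `σ`, as a linear map into the semi-inner product space of `f`. -/
def toPre : PullbackGNS σ f →ₗ[ℂ] f.PreGNS :=
  f.toPreGNS.toLinearMap ∘ₗ (σ : B →ₗ[ℂ] E) ∘ₗ (of σ f).symm.toLinearMap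

theorem toPre_of (x : B) : toPre σ f (of σ f x) = f.toPreGNS (σ x) := rfl

/-- The semi-inner product of the copy. -/
abbrev core : PreInnerProductSpace.Core ℂ (PullbackGNS σ f) where
  inner x y := ⟪toPre σ f x, toPre σ f y⟫_ℂ
  conj_inner_symm _ _ := inner_conj_symm _ _
  re_inner_nonneg _ := inner_self_nonneg
  add_left _ _ _ := by rw [map_add, inner_add_left]
  smul_left _ _ _ := by rw [map_smul, inner_smul_left]

instance : SeminormedAddCommGroup (PullbackGNS σ f) :=
  InnerProductSpace.Core.toSeminormedAddCommGroup (c := core σ f)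
instance : InnerProductSpace ℂ (PullbackGNS σ f) := InnerProductSpace.ofCore (core σ f)

theorem inner_def (x y : PullbackGNS σ f) : ⟪x, y⟫_ℂ = ⟪toPre σ f x, toPre σ f y⟫_ℂ := rfl

theorem norm_def (x : PullbackGNS σ f) : ‖x‖ = ‖toPre σ f x‖ := by
  rw [norm_eq_sqrt_re_inner (𝕜 := ℂ) x, norm_eq_sqrt_re_inner (𝕜 := ℂ) (toPre σ f x), inner_def]

theorem inner_of (x y : B) : ⟪of σ f x, of σ f y⟫_ℂ = f (star (σ x) * σ y) := rfl

theorem norm_of_sq (x : B) : ((‖of σ f x‖ ^ 2 : ℝ) : ℂ) = f (star (σ x) * σ x) := by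
  rw [norm_def, toPre_of, Complex.ofReal_pow, f.preGNS_norm_sq]
  rfl

/-- Since σ intertwines left multiplication by x with left multiplication by σ(x), the operator
bound known on the GNS space of f passes to the copy of B. No continuity of σ enters. -/
theorem toPre_mul (x : B) (y : PullbackGNS σ f) :
    toPre σ f (of σ f (x * (of σ f).symm y)) = f.leftMulMapPreGNS (σ x) (toPre σ f y) :=
  congrArg f.toPreGNS (map_mul σ x _)

/-- Left multiplication by `x`. -/
def leftMul (x : B) : PullbackGNS σ f →L[ℂ] PullbackGNS σ f :=
  LinearMap.mkContinuous ((of σ f).toLinearMap ∘ₗ LinearMap.mulLeft ℂ x ∘ₗ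
    (of σ f).symm.toLinearMap) ‖f.leftMulMapPreGNS (σ x)‖ fun y => by
      rw [norm_def, norm_def]
      exact (congrArg norm (toPre_mul σ f x y)).trans_le (ContinuousLinearMap.le_opNorm _ _)

theorem leftMul_of (x y : B) : leftMul σ f x (of σ f y) = of σ f (x * y) := rfl

variable {σ f} in
/-- Operators on the completion that agree on `B` are equal. -/
theorem operator_ext
    {S T : Completion (PullbackGNS σ f) →L[ℂ] Completion (PullbackGNS σ f)}
    (h : ∀ x : B, S (of σ f x : Completion (PullbackGNS σ f)) =
      T (of σ f x : Completion (PullbackGNS σ f))) : S = T :=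
  ContinuousLinearMap.ext fun y => Completion.induction_on y
    (isClosed_eq S.continuous T.continuous) h

/-- The representation of `B` by left multiplications on the completion of the copy. -/
def hom : B →⋆ₙₐ[ℂ] (Completion (PullbackGNS σ f) →L[ℂ] Completion (PullbackGNS σ f)) where
  toFun x := (leftMul σ f x).completion
  map_smul' c x := by
    refine operator_ext fun y => ?_
    simp only [MonoidHom.id_apply, smul_apply, ContinuousLinearMap.completion_apply_coe,
      ← Completion.coe_smul, leftMul_of, smul_mul_assoc, map_smul]
  map_zero' := by
    refine operator_ext fun y => ?_
    simp only [zero_apply, ContinuousLinearMap.completion_apply_coe, ← Completion.coe_zero,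
      leftMul_of, zero_mul, map_zero]
  map_add' x x' := by
    refine operator_ext fun y => ?_
    simp only [add_apply, ContinuousLinearMap.completion_apply_coe, ← Completion.coe_add,
      leftMul_of, add_mul, map_add]
  map_mul' x x' := by
    refine operator_ext fun y => ?_
    simp only [mul_apply_eq_comp, ContinuousLinearMap.completion_apply_coe,
      leftMul_of, mul_assoc]
  map_star' x := by
    -- On vectors from B both inner products equal f(σ(y)⋆ σ(x) σ(z)); density and continuity give
    -- the rest.
    refine (ContinuousLinearMap.eq_adjoint_iff (leftMul σ f (star x)).completion
      (leftMul σ f x).completion).mpr fun y z => ?_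
    induction y, z using Completion.induction_on₂ with
    | hp => apply isClosed_eq <;> fun_prop
    | ih y z =>
      obtain ⟨y, rfl⟩ := (of σ f).surjective y
      obtain ⟨z, rfl⟩ := (of σ f).surjective z
      simp only [ContinuousLinearMap.completion_apply_coe, Completion.inner_coe, leftMul_of,
        inner_of, map_mul, map_star, star_mul, star_star, mul_assoc]

/-- The Hilbert space representation defined by `σ` and `f`. It acts on a space in the universe
of `B`, wherever `E` is. -/
def rep : HilbertRep B where
  H := Completion (PullbackGNS σ f)
  π := hom σ f

/-- Left multiplication by x extends to the operator by which x acts in `rep σ f`, one of the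
representations over which the supremum `envNorm x` is taken. -/
theorem norm_of_mul_le (x y : B) :
    ‖of σ f (x * y)‖ ≤ envNorm x * ‖of σ f y‖ := by
  have h : (hom σ f x) (of σ f y : Completion (PullbackGNS σ f)) =
      (of σ f (x * y) : Completion (PullbackGNS σ f)) :=
    ContinuousLinearMap.completion_apply_coe _ _
  rw [← Completion.norm_coe, ← h, ← Completion.norm_coe (of σ f y)]
  exact (ContinuousLinearMap.le_opNorm _ _).trans
    (mul_le_mul_of_nonneg_right (le_envNorm (rep σ f) x) (norm_nonneg _))

end PullbackGNS

end GNS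

/-! ### Domination by the enveloping seminorm -/

/-- Every `*`-homomorphism of a Banach `*`-algebra to a unital C⋆-algebra, in whatever universe, is
bounded by the enveloping C⋆-seminorm. -/
theorem norm_map_le_envNorm {B : Type u} [BanachStarAlgebra B] {E : Type v} [CStarAlgebra E]
    (σ : B →⋆ₙₐ[ℂ] E) (x : B) : ‖σ x‖ ≤ envNorm x := by
  let _ : PartialOrder E := CStarAlgebra.spectralOrder E
  have _ : StarOrderedRing E := CStarAlgebra.spectralOrderedRing E
  -- B need not have a unit, so there may be no vector coming from 1 to test on; x⋆ is used instead.
  -- Its image x x⋆ has squared seminorm f(d⋆d), which is as large as possible when f norms d⋆d.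
  set d : E := σ x * star (σ x)
  have nd : ‖d‖ = ‖σ x‖ ^ 2 := by rw [sq]; exact CStarRing.norm_self_mul_star
  have ndd : ‖star d * d‖ = ‖σ x‖ ^ 4 := by rw [CStarRing.norm_star_mul_self, nd]; ring
  obtain ⟨f, hf, hfb⟩ := exists_positive_apply_eq_norm (star_mul_self_nonneg d)
  have h := PullbackGNS.norm_of_mul_le σ f x (star x)
  have h1 : ‖PullbackGNS.of σ f (x * star x)‖ ^ 2 = ‖σ x‖ ^ 4 := by
    have := PullbackGNS.norm_of_sq σ f (x * star x)
    rw [map_mul σ, map_star σ, hf, ndd] at this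
    exact_mod_cast this
  -- The squared seminorm of x⋆ is f(d), and f is contractive.
  have h2 : ‖PullbackGNS.of σ f (star x)‖ ^ 2 ≤ ‖σ x‖ ^ 2 := by
    have := PullbackGNS.norm_of_sq σ f (star x)
    rw [map_star σ, star_star] at this
    have hb := hfb d
    rwa [← this, nd, Complex.norm_real, Real.norm_of_nonneg (sq_nonneg _)] at hb
  have h3 : ‖PullbackGNS.of σ f (x * star x)‖ = ‖σ x‖ ^ 2 :=
    (pow_left_inj₀ (norm_nonneg _) (sq_nonneg _) two_ne_zero).1 (by rw [h1]; ring)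
  have h4 : ‖PullbackGNS.of σ f (star x)‖ ≤ ‖σ x‖ :=
    (pow_le_pow_iff_left₀ (norm_nonneg _) (norm_nonneg _) two_ne_zero).1 h2
  -- What has been shown is ‖σ x‖² ≤ `envNorm x` · ‖σ x‖; cancelling a factor requires ‖σ x‖ > 0.
  rcases (norm_nonneg (σ x)).eq_or_lt with h0 | h0
  · rw [← h0]; exact envNorm_nonneg x
  · rw [h3, sq] at h
    exact le_of_mul_le_mul_right (h.trans (mul_le_mul_of_nonneg_left h4 (envNorm_nonneg x))) h0

/-! ### Extension of homomorphisms to the enveloping C⋆-algebra -/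

namespace CStarEnvelope

open UniformSpace

variable {B : Type u} [BanachStarAlgebra B]

section lift

variable {E : Type v} [CStarAlgebra E] (σ : B →⋆ₙₐ[ℂ] E)

/-- The map underlying `lift`. -/
def liftFun : CStarEnvelope B → E := Completion.extension (α := PreEnvelope B) σ

/-- The norm on `PreEnvelope B` is the enveloping seminorm, so `norm_map_le_envNorm` says that σ is
1-Lipschitz. This is what makes the extension to the completion agree with σ on B. -/
theorem uniformContinuous_pre :
    UniformContinuous (show PreEnvelope B → E from σ) :=
  (AddMonoidHomClass.lipschitz_of_bound
    (show PreEnvelope B →+ E from (σ : B →+ E)) 1 fun x => by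
      rw [one_mul]
      exact norm_map_le_envNorm σ x).uniformContinuous

theorem liftFun_coe (x : B) : liftFun σ (coe x) = σ x :=
  Completion.extension_coe (α := PreEnvelope B) (uniformContinuous_pre σ) x

theorem continuous_liftFun : Continuous (liftFun σ) :=
  Completion.continuous_extension (α := PreEnvelope B)

/-- The extension of a `*`-homomorphism to the enveloping C⋆-algebra. -/
def lift : CStarEnvelope B →⋆ₙₐ[ℂ] E where
  toFun := liftFun σ
  map_smul' c := by
    refine isClosed_property denseRange_coe ?_ fun x => ?_
    · exact isClosed_eq ((continuous_liftFun σ).comp (continuous_const_smul c))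
        ((continuous_liftFun σ).const_smul c)
    · rw [← coe_smul, liftFun_coe, liftFun_coe, map_smul]
      rfl
  map_zero' := by rw [← coe_zero, liftFun_coe, map_zero]
  map_add' := by
    refine isClosed_property2 denseRange_coe ?_ fun x y => ?_
    · exact isClosed_eq ((continuous_liftFun σ).comp continuous_add)
        (((continuous_liftFun σ).comp continuous_fst).add
          ((continuous_liftFun σ).comp continuous_snd))
    · rw [← coe_add, liftFun_coe, liftFun_coe, liftFun_coe, map_add]
  map_mul' := by
    refine isClosed_property2 denseRange_coe ?_ fun x y => ?_
    · exact isClosed_eq ((continuous_liftFun σ).comp continuous_mul)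
        (((continuous_liftFun σ).comp continuous_fst).mul
          ((continuous_liftFun σ).comp continuous_snd))
    · rw [← coe_mul, liftFun_coe, liftFun_coe, liftFun_coe, map_mul]
  map_star' := by
    refine isClosed_property denseRange_coe ?_ fun x => ?_
    · exact isClosed_eq ((continuous_liftFun σ).comp continuous_star')
        (continuous_liftFun σ).star
    · rw [← coe_star, liftFun_coe, liftFun_coe, map_star]

theorem lift_of (x : B) : lift σ (of B x) = σ x := liftFun_coe σ x

end lift

end CStarEnvelope

end BanachStarAlgebra

/-! ### Homomorphisms from `ℓ¹(Σ)` to a unital C⋆-algebra -/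

namespace L1Sigma

open BanachStarAlgebra

variable {A : Type u} [NonUnitalCStarAlgebra A]

section lift

variable {E : Type v} [CStarAlgebra E] (π : ℕ → A →⋆ₙₐ[ℂ] E)

/-- The product `π_{n₁}(a₁) ⋯ π_{nₖ}(aₖ)`. -/
def wordEval (u : List (ℕ × A)) : E := (u.map fun p => π p.1 p.2).prod

theorem wordEval_cons (x : ℕ × A) (u : List (ℕ × A)) :
    wordEval π (x :: u) = π x.1 x.2 * wordEval π u := by
  rw [wordEval, List.map_cons, List.prod_cons, wordEval]

/-- Only the last letter of u and the first letter of v can interact. If their indices agree they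
merge, and multiplicativity of that one π_k gives the identity; otherwise the words are
concatenated. With 1 as the empty product, empty words fit too. -/
theorem wordEval_wordMul : ∀ u v : List (ℕ × A),
    wordEval π (wordMul u v) = wordEval π u * wordEval π v
  | [], v => by simp [wordMul, wordEval]
  | [x], [] => by simp [wordMul, wordEval]
  | [x], y :: ys => by
    by_cases h : x.1 = y.1 <;> simp [wordMul, wordEval, h, mul_assoc]
  | x :: x' :: xs, v => by
    rw [wordMul, wordEval_cons, wordEval_wordMul (x' :: xs) v, wordEval_cons π x, mul_assoc]

theorem wordEval_wordStar (u : List (ℕ × A)) :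
    wordEval π (wordStar u) = star (wordEval π u) := by
  induction u with
  | nil => simp [wordStar, wordEval]
  | cons x u ih =>
    rw [wordEval_cons, star_mul, ← ih]
    simp [wordStar, wordEval, map_star (π x.1)]

/-- The map `(a₁, …, aₖ) ↦ π_{n₁}(a₁) ⋯ π_{nₖ}(aₖ)`, where `μ = (n₁, …, nₖ)`. -/
def tupleEval (μ : AltSeq) : ContinuousMultilinearMap ℂ (fun _ : Fin μ.length => A) E :=
  (ContinuousMultilinearMap.mkPiAlgebraFin ℂ μ.length E).compContinuousLinearMap
    fun i => (π (μ.val[i.1]'i.2) : A →ₗ[ℂ] E).mkContinuous 1 fun a => by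
      rw [one_mul]; exact NonUnitalStarAlgHom.norm_apply_le (π (μ.val[i.1]'i.2)) a

theorem tupleEval_apply (μ : AltSeq) (a : Fin μ.length → A) :
    tupleEval π μ a = wordEval π (word μ a) := by
  rw [wordEval, word, List.map_ofFn]
  rfl

theorem norm_tupleEval_le (μ : AltSeq) : ‖tupleEval π μ‖ ≤ 1 := by
  refine ContinuousMultilinearMap.opNorm_le_bound zero_le_one fun a => ?_
  rw [tupleEval_apply, one_mul, ← word_prod, wordEval]
  -- The word is nonempty, so the bound needs no ‖1‖ = 1 and holds also if E is zero.
  refine (List.norm_prod_le' (by simpa using word_ne_nil μ a)).trans ?_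
  rw [List.map_map]
  exact List.prod_map_le_prod_map₀ _ _ (fun _ _ => norm_nonneg _)
    fun p _ => NonUnitalStarAlgHom.norm_apply_le (π p.1) p.2

theorem norm_lift_tupleEval_le (μ : AltSeq) (ξ : ProjPower A μ.length) :
    ‖ProjPower.lift (tupleEval π μ) ξ‖ ≤ ‖ξ‖ :=
  (ProjPower.norm_lift_apply_le _ ξ).trans
    (mul_le_of_le_one_left (norm_nonneg ξ) (norm_tupleEval_le π μ))

theorem summable_lift_tupleEval (f : L1Sigma A) :
    Summable fun μ => ProjPower.lift (tupleEval π μ) (f μ) :=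
  .of_norm_bounded (hasSum_norm f).summable fun μ => norm_lift_tupleEval_le π μ (f μ)

/-- The bounded linear map `f ↦ ∑ π_μ(f(μ))`, where
`π_μ(a₁ ⊗ ⋯ ⊗ aₖ) = π_{n₁}(a₁) ⋯ π_{nₖ}(aₖ)`. -/
def liftCLM : L1Sigma A →L[ℂ] E :=
  LinearMap.mkContinuous
    { toFun := fun f => ∑' μ, ProjPower.lift (tupleEval π μ) (f μ)
      map_add' := fun f g => by
        rw [← (summable_lift_tupleEval π f).tsum_add (summable_lift_tupleEval π g)]
        exact tsum_congr fun μ => by rw [add_apply, map_add]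
      map_smul' := fun c f => by
        rw [RingHom.id_apply, ← (summable_lift_tupleEval π f).tsum_const_smul]
        exact tsum_congr fun μ => by rw [smul_apply, map_smul] }
    1 fun f => by
      rw [one_mul]
      exact tsum_of_norm_bounded (hasSum_norm f) fun μ => norm_lift_tupleEval_le π μ (f μ)

theorem liftCLM_elem (μ : AltSeq) (a : Fin μ.length → A) :
    liftCLM π (elem μ a) = wordEval π (word μ a) := by
  change ∑' ν, ProjPower.lift (tupleEval π ν) (elem μ a ν) = _
  rw [tsum_eq_single μ fun ν h => by rw [elem, delta_apply_ne h, map_zero], elem,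
    delta_apply_self, ProjPower.lift_tensor, tupleEval_apply]

/-- Both sides are linear and continuous in each variable, so it suffices to take elementary
functions, where the claim is `wordEval_wordMul`. -/
theorem liftCLM_mul (f g : L1Sigma A) : liftCLM π (f * g) = liftCLM π f * liftCLM π g := by
  refine induction_on (p := fun f => liftCLM π (f * g) = liftCLM π f * liftCLM π g)
    (isClosed_eq ((liftCLM π).continuous.comp (continuous_mul_right g))
      ((liftCLM π).continuous.mul continuous_const)) (fun c μ a => ?_) (fun f f' h1 h2 => ?_) f
  swap
  · rw [add_mul, map_add, map_add, add_mul, h1, h2]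
  rw [smul_mul_assoc, map_smul, map_smul, smul_mul_assoc]
  congr 1
  refine induction_on
    (p := fun g => liftCLM π (elem μ a * g) = liftCLM π (elem μ a) * liftCLM π g)
    (isClosed_eq ((liftCLM π).continuous.comp (continuous_mul_left _))
      (continuous_const.mul (liftCLM π).continuous)) (fun c ν b => ?_) (fun f f' h1 h2 => ?_) g
  swap
  · rw [mul_add, map_add, map_add, mul_add, h1, h2]
  rw [mul_smul_comm, map_smul, map_smul, mul_smul_comm, elem_mul_elem, liftCLM_elem,
    liftCLM_elem, liftCLM_elem, word_mulTuple, wordEval_wordMul]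

theorem liftCLM_star (f : L1Sigma A) : liftCLM π (star f) = star (liftCLM π f) := by
  refine induction_on (p := fun f => liftCLM π (star f) = star (liftCLM π f))
    (isClosed_eq ((liftCLM π).continuous.comp continuous_star') (liftCLM π).continuous.star)
    (fun c μ a => ?_) (fun f f' h1 h2 => ?_) f
  · rw [star_smul, map_smul, map_smul, star_smul, star_elem, liftCLM_elem, liftCLM_elem,
      word_starTuple, wordEval_wordStar]
  · rw [star_add, map_add, map_add, star_add, h1, h2]

/-- The `*`-homomorphism of `ℓ¹(Σ)` defined by a sequence of `*`-homomorphisms of `A` to a unital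
C⋆-algebra. -/
def lift : L1Sigma A →⋆ₙₐ[ℂ] E where
  toFun := liftCLM π
  map_smul' := map_smul (liftCLM π)
  map_zero' := map_zero (liftCLM π)
  map_add' := map_add (liftCLM π)
  map_mul' := liftCLM_mul π
  map_star' := liftCLM_star π

theorem lift_theta (k : ℕ) (a : A) : lift π (theta k a) = π k a := by
  refine (liftCLM_elem π (AltSeq.single k) fun _ => a).trans ?_
  rw [word_single]
  simp [wordEval]

end lift

/-! ### Generation by the ranges of the `θ_k` -/

/-- A sequence with at least two terms is the product of its first term and the rest. -/
theorem elem_cons (k k' : ℕ) (l : List ℕ) (h : (k :: k' :: l).IsChain (· ≠ ·))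
    (a : Fin (k :: k' :: l).length → A) :
    elem ⟨k :: k' :: l, by simp, h⟩ a =
      theta k (a 0) * elem ⟨k' :: l, by simp, h.tail⟩ fun i => a i.succ := by
  refine Eq.trans (elem_congr ?_) (elem_mul_elem _ _ _ _).symm
  rw [word_mulTuple, word_single]
  -- Distinct neighbours put the product in the concatenating case, so no letters merge.
  have hk : k ≠ k' := (List.isChain_cons_cons.1 h).1
  simp only [word, AltSeq.length, List.ofFn_succ, List.length_cons, wordMul]
  simp [hk]

/-- A subalgebra that contains the ranges of the `θ_k` contains the elementary functions. -/
theorem elem_mem {S : NonUnitalStarSubalgebra ℂ (L1Sigma A)}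
    (hS : ∀ k a, theta k a ∈ S) (μ : AltSeq) (a : Fin μ.length → A) : elem μ a ∈ S := by
  obtain ⟨l, hl, hc⟩ := μ
  induction l with
  | nil => exact absurd rfl hl
  | cons k l ih =>
    cases l with
    | nil =>
      -- A 1-tuple is constant, which is the form in which `theta` is defined.
      have : a = fun _ => a ⟨0, Nat.one_pos⟩ := by
        funext i
        exact congrArg a (Subsingleton.elim (α := Fin 1) i _)
      rw [this]
      exact hS k _
    | cons k' l =>
      exact (elem_cons k k' l hc a).symm ▸ S.mul_mem (hS k _) (ih _ _ _)

theorem dense_adjoin_theta :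
    Dense (NonUnitalStarAlgebra.adjoin ℂ (⋃ k, Set.range (theta (A := A) k)) : Set (L1Sigma A)) := by
  intro f
  refine induction_on (p := fun f => f ∈ closure
    (NonUnitalStarAlgebra.adjoin ℂ (⋃ k, Set.range (theta (A := A) k)) : Set (L1Sigma A)))
    isClosed_closure (fun c μ a => ?_) (fun f g hf hg => ?_) f
  · refine subset_closure (SMulMemClass.smul_mem c (elem_mem (fun k a => ?_) μ a))
    exact NonUnitalStarAlgebra.subset_adjoin ℂ _ (Set.mem_iUnion.2 ⟨k, a, rfl⟩)
  · exact (NonUnitalStarAlgebra.adjoin ℂ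
      (⋃ k, Set.range (theta (A := A) k))).toNonUnitalSubalgebra.toAddSubmonoid.topologicalClosure.add_mem
        hf hg

end L1Sigma

/-! ### The universal property of the enveloping C⋆-algebra -/

section FreeProduct

variable {A : Type u} [NonUnitalCStarAlgebra A]

open BanachStarAlgebra

/-- The canonical map is continuous with dense range, so it carries a dense subalgebra onto a dense
one, and it carries the subalgebra generated by a set onto the one generated by its image. -/
theorem dense_adjoin_thetaTilde :
    Dense (NonUnitalStarAlgebra.adjoin ℂ (⋃ k, Set.range (thetaTilde (A := A) k)) :
      Set (CStarEnvelope (L1Sigma A))) := by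
  have hc : Continuous (CStarEnvelope.of (L1Sigma A)) :=
    AddMonoidHomClass.continuous_of_bound _ 1 fun x => by
      rw [one_mul]
      exact (CStarEnvelope.norm_coe x).trans_le (envNorm_le_norm x)
  have hd : DenseRange (CStarEnvelope.of (L1Sigma A)) := CStarEnvelope.denseRange_coe
  have := hd.dense_image hc L1Sigma.dense_adjoin_theta
  rw [← NonUnitalStarSubalgebra.coe_map, NonUnitalStarAlgHom.map_adjoin, Set.image_iUnion] at this
  simp only [← Set.range_comp] at this
  exact this

/-- `*`-homomorphisms of C⋆-algebras that agree on generators are equal. -/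
theorem NonUnitalStarAlgHom.ext_of_dense_adjoin {P : Type v} [NonUnitalCStarAlgebra P]
    {θ : ℕ → A →⋆ₙₐ[ℂ] P}
    (hθ : Dense (NonUnitalStarAlgebra.adjoin ℂ (⋃ k, Set.range (θ k)) : Set P))
    {D : Type w} [NonUnitalCStarAlgebra D] {ρ₁ ρ₂ : P →⋆ₙₐ[ℂ] D}
    (h : ∀ k a, ρ₁ (θ k a) = ρ₂ (θ k a)) : ρ₁ = ρ₂ := by
  have hc : ∀ ρ : P →⋆ₙₐ[ℂ] D, Continuous ρ := fun ρ =>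
    AddMonoidHomClass.continuous_of_bound ρ 1 fun x => by
      rw [one_mul]; exact NonUnitalStarAlgHom.norm_apply_le ρ x
  refine DFunLike.coe_injective ((hc ρ₁).ext_on hθ (hc ρ₂) fun x hx => ?_)
  have : NonUnitalStarAlgebra.adjoin ℂ (⋃ k, Set.range (θ k)) ≤
      NonUnitalStarAlgHom.equalizer ρ₁ ρ₂ :=
    NonUnitalStarAlgebra.adjoin_le (Set.iUnion_subset fun k => by
      rintro _ ⟨a, rfl⟩
      exact h k a)
  exact this hx

/-- Every sequence of `*`-homomorphisms of `A` to a C⋆-algebra factors through `C⋆(ℓ¹(Σ))`. -/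
theorem exists_comp_thetaTilde_eq {D : Type v} [NonUnitalCStarAlgebra D]
    (π : ℕ → A →⋆ₙₐ[ℂ] D) :
    ∃ ρ : CStarEnvelope (L1Sigma A) →⋆ₙₐ[ℂ] D, ∀ k a, ρ (thetaTilde k a) = π k a := by
  -- The extension results take unital targets, so D is replaced by its unitization.
  let ι := Unitization.inrNonUnitalStarAlgHom ℂ D
  let τ := CStarEnvelope.lift (L1Sigma.lift fun k => ι.comp (π k))
  have hτ : ∀ k a, τ (thetaTilde k a) = ι (π k a) := fun k a =>
    (CStarEnvelope.lift_of _ _).trans (L1Sigma.lift_theta _ k a)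
  let ε : Unitization ℂ D →⋆ₙₐ[ℂ] ℂ :=
    { toFun := fun x => x.fst
      map_smul' := Unitization.fst_smul
      map_zero' := Unitization.fst_zero
      map_add' := Unitization.fst_add
      map_mul' := Unitization.fst_mul
      map_star' := Unitization.fst_star }
  -- The scalar part is itself a `*`-homomorphism to ℂ and kills every generator, hence vanishes. So
  -- τ maps into the ideal D.
  have hε : ε.comp τ = 0 := NonUnitalStarAlgHom.ext_of_dense_adjoin dense_adjoin_thetaTilde
    fun k a => by rw [NonUnitalStarAlgHom.comp_apply, hτ]; exact Unitization.fst_inr ℂ (π k a)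
  have h0 : ∀ x, (τ x).fst = 0 := DFunLike.congr_fun hε
  refine ⟨{ toFun := fun x => (τ x).snd
            map_smul' := fun c x => by rw [map_smul, Unitization.snd_smul]; rfl
            map_zero' := by rw [map_zero, Unitization.snd_zero]
            map_add' := fun x y => by rw [map_add, Unitization.snd_add]
            map_mul' := fun x y => by
              -- The D-component of a product has two cross terms with the scalar parts; these
              -- vanish by `h0`.
              rw [map_mul, Unitization.snd_mul, h0, h0, zero_smul, zero_smul, zero_add, zero_add]
            map_star' := fun x => by rw [map_star, Unitization.snd_star] }, fun k a => ?_⟩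
  exact (congrArg (fun x : Unitization ℂ D => x.snd) (hτ k a)).trans (Unitization.snd_inr ℂ _)

end FreeProduct

end

theorem proposition3p1 (A : Type u) [NonUnitalCStarAlgebra A] :
    IsInfiniteFreeProduct.{u, v, u}
      (thetaTilde : ℕ → A →⋆ₙₐ[ℂ] BanachStarAlgebra.CStarEnvelope (L1Sigma A)) ∧
    ∀ (P : Type w) [NonUnitalCStarAlgebra P] (θ : ℕ → A →⋆ₙₐ[ℂ] P),
      IsInfiniteFreeProduct.{u, u, w} θ →
      ∃! e : BanachStarAlgebra.CStarEnvelope (L1Sigma A) ≃⋆ₐ[ℂ] P,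
        ∀ (k : ℕ) (a : A), e (thetaTilde k a) = θ k a := by
  refine ⟨⟨dense_adjoin_thetaTilde, fun D _ π => ?_⟩, fun P _ θ hθ => ?_⟩
  · obtain ⟨ρ, hρ⟩ := exists_comp_thetaTilde_eq π
    exact ⟨ρ, fun k => NonUnitalStarAlgHom.ext (hρ k), fun ρ' h =>
      NonUnitalStarAlgHom.ext_of_dense_adjoin dense_adjoin_thetaTilde fun k a =>
        (DFunLike.congr_fun (h k) a).trans (hρ k a).symm⟩
  · obtain ⟨ρ, hρ⟩ := exists_comp_thetaTilde_eq θ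
    -- Of the universal property of P only existence is needed, and only for the target C⋆(ℓ¹(Σ)),
    -- which lies in the universe of A. The composites of ρ and κ fix the generators, so both are
    -- identities.
    obtain ⟨κ, hκ, -⟩ := hθ.existsUnique_factor _ (thetaTilde (A := A))
    have hκ' : ∀ k a, κ (θ k a) = thetaTilde k a := fun k a => DFunLike.congr_fun (hκ k) a
    have h1 : κ.comp ρ = NonUnitalStarAlgHom.id ℂ _ :=
      NonUnitalStarAlgHom.ext_of_dense_adjoin dense_adjoin_thetaTilde fun k a => by
        rw [NonUnitalStarAlgHom.comp_apply, hρ, hκ', NonUnitalStarAlgHom.coe_id, id]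
    have h2 : ρ.comp κ = NonUnitalStarAlgHom.id ℂ _ :=
      NonUnitalStarAlgHom.ext_of_dense_adjoin hθ.generates fun k a => by
        rw [NonUnitalStarAlgHom.comp_apply, hκ', hρ, NonUnitalStarAlgHom.coe_id, id]
    refine ⟨{ ρ with
        toFun := ρ
        invFun := κ
        left_inv := DFunLike.congr_fun h1
        right_inv := DFunLike.congr_fun h2 }, hρ, fun e he => ?_⟩
    have h3 : (e : BanachStarAlgebra.CStarEnvelope (L1Sigma A) →⋆ₙₐ[ℂ] P) = ρ :=
      NonUnitalStarAlgHom.ext_of_dense_adjoin dense_adjoin_thetaTilde fun k a =>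
        (he k a).trans (hρ k a).symm
    exact StarAlgEquiv.ext fun x => DFunLike.congr_fun h3 x
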